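/- A *symmetric 2-group* is a symmetric monoidal category $(\mathcal A,+,0)$ in which every morphism is invertible and every object $X$ has some $Y$ with $X+Y\cong 0$. The 2-category $(2\text{-}\mathrm{SGp})$ has symmetric 2-groups as objects, strong symmetric monoidal functors as 1-morphisms and monoidal natural transformations as 2-morphisms; $0$ also denotes the 1-morphism that is constant at the unit object, and $F+G$ the pointwise sum of two 1-morphisms. A *2-chain complex* $\mathcal A_\cdot=(\mathcal A_n,L_n,\alpha_n)_{n\in\mathbb Z}$ consists of symmetric 2-groups $\mathcal A_n$, 1-morphisms $L_n:\mathcal A_n\to\mathcal A_{n-1}$ and 2-morphisms $\alpha_n:L_{n-1}\circ L_n\Rightarrow 0$ such that, up to the canonical isomorphism $L_{n-2}(0)\cong 0$, $L_{n-2}((\alpha_n)_X)=(\alpha_{n-1})_{L_n(X)}$ for all $n$ and all $X\in\mathcal A_n$. (A complex $\cdots\to\mathcal A_1\to\mathcal A_0$ is regarded as such a complex by completing it with zeros on the right.) A *morphism* $(F_\cdot,\lambda_\cdot):\mathcal A_\cdot\to\mathcal B_\cdot=(\mathcal B_n,M_n,\beta_n)$ consists of 1-morphisms $F_n:\mathcal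 A_n\to\mathcal B_n$ and 2-morphisms $\lambda_n:F_{n-1}\circ L_n\Rightarrow M_n\circ F_n$ such that, for all $n$ and $X\in\mathcal A_n$, the composite $$F_{n-2}L_{n-1}L_n X\xrightarrow{\lambda_{n-1}}M_{n-1}F_{n-1}L_nX\xrightarrow{M_{n-1}(\lambda_n)}M_{n-1}M_nF_nX\xrightarrow{\beta_n}0$$ equals $F_{n-2}L_{n-1}L_nX\xrightarrow{F_{n-2}(\alpha_n)}F_{n-2}(0)\cong 0$. A *2-chain homotopy* from $(F_\cdot,\lambda_\cdot)$ to $(G_\cdot,\mu_\cdot)$ consists of 1-morphisms $H_n:\mathcal A_n\to\mathcal B_{n+1}$ and 2-morphisms $\tau_n:F_n\Rightarrow M_{n+1}\circ H_n+H_{n-1}\circ L_n+G_n$ $(n\in\mathbb Z)$ such that, for all $n$ and all $X\in\mathcal A_n$, the two morphisms $F_{n-1}L_nX\to M_nH_{n-1}L_nX+M_nG_nX$ given by $$F_{n-1}L_nX\xrightarrow{\lambda_n}M_nF_nX\xrightarrow{M_n(\tau_n)}M_n(M_{n+1}H_nX+H_{n-1}L_nX+G_nX)\cong M_nM_{n+1}H_nX+M_nH_{n-1}L_nX+M_nG_nX\xrightarrow{\beta_{n+1}+1+1}M_nH_{n-1}L_nX+M_nG_nX$$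 and $$F_{n-1}L_nX\xrightarrow{\tau_{n-1}}M_nH_{n-1}L_nX+H_{n-2}L_{n-1}L_nX+G_{n-1}L_nX\xrightarrow{1+H_{n-2}(\alpha_n)+\mu_n}M_nH_{n-1}L_nX+M_nG_nX$$ coincide (canonical isomorphisms of unit objects omitted). The $n$-th *homology symmetric 2-group* $\mathcal H_n(\mathcal A_\cdot)$ is the relative cokernel $\mathrm{Coker}(\overline{\alpha_{n+2}},L'_{n+1})$ of $\mathcal A_{n+2}\xrightarrow{L_{n+2}}\mathcal A_{n+1}\xrightarrow{L'_{n+1}}\mathrm{Ker}(L_n,\alpha_n)$. Here $\mathrm{Ker}(L_n,\alpha_n)$ is the relative kernel, with objects the pairs $(A,\ a:L_n(A)\to 0)$ such that $L_{n-1}(a)=(\alpha_n)_A$ and morphisms those $f:A\to A'$ with $a'\circ L_n(f)=a$; $L'_{n+1}(X)=(L_{n+1}X,(\alpha_{n+1})_X)$; and $\overline{\alpha_{n+2}}:L'_{n+1}\circ L_{n+2}\Rightarrow 0$ has the components of $\alpha_{n+2}$. The relative cokernel $\mathrm{Coker}(\varphi,Q)$ of a sequence $\mathcal X\xrightarrow{P}\mathcal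 Y\xrightarrow{Q}\mathcal Z$, $\varphi:Q\circ P\Rightarrow0$, has the objects of $\mathcal Z$; its morphisms $Z\to Z'$ are the classes of pairs $(Y\in\mathcal Y,\ f:Z\to Q(Y)+Z')$, where $(Y,f)$ and $(Y',f')$ are identified if for some $X\in\mathcal X$ and $t:Y\to P(X)+Y'$ the composite $Z\xrightarrow{f}Q(Y)+Z'\xrightarrow{Q(t)+1}Q(P(X)+Y')+Z'\cong QP(X)+Q(Y')+Z'\xrightarrow{\varphi_X+1+1}Q(Y')+Z'$ is $f'$. A morphism $(F_\cdot,\lambda_\cdot)$ induces a 1-morphism $\mathcal H_n(F_\cdot):\mathcal H_n(\mathcal A_\cdot)\to\mathcal H_n(\mathcal B_\cdot)$ that sends $(A,a)$ to $(F_nA,\ M_nF_nA\xrightarrow{\lambda_n^{-1}}F_{n-1}L_nA\xrightarrow{F_{n-1}(a)}F_{n-1}(0)\cong 0)$ and the class of $(X,\ x:A\to L_{n+1}X+A')$ to the class of $(F_{n+1}X,\ F_nA\xrightarrow{F_n(x)}F_n(L_{n+1}X+A')\cong F_nL_{n+1}X+F_nA'\xrightarrow{\lambda_{n+1}+1}M_{n+1}F_{n+1}X+F_nA')$.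 **Proposition 1.** Let $(F_\cdot,\lambda_\cdot),(G_\cdot,\mu_\cdot):\mathcal A_\cdot\to\mathcal B_\cdot$ be two morphisms of 2-chain complexes of symmetric 2-groups. If there is a 2-chain homotopy from $(F_\cdot,\lambda_\cdot)$ to $(G_\cdot,\mu_\cdot)$, then for every $n$ the induced 1-morphisms $\mathcal H_n(F_\cdot)$ and $\mathcal H_n(G_\cdot)$ are equivalent: there is an invertible 2-morphism $\mathcal H_n(F_\cdot)\Rightarrow\mathcal H_n(G_\cdot)$ in $(2\text{-}\mathrm{SGp})$, that is, a monoidal natural isomorphism. -/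

import Mathlib

set_option linter.unusedSectionVars false

open CategoryTheory MonoidalCategory
open Functor.LaxMonoidal Functor.OplaxMonoidal Functor.Monoidal

/-- A monoidal category is a 2-group (categorical group) if every morphism is invertible and every
object has an inverse up to isomorphism for the tensor product. -/
class IsTwoGroup (C : Type*) [Category C] [MonoidalCategory C] : Prop extends IsGroupoid C where
  exists_inverse : ∀ X : C, ∃ Y : C, Nonempty (X ⊗ Y ≅ 𝟙_ C)

section Unbundled

variable {A : Type*} [Category A] [MonoidalCategory A]
variable {B : Type*} [Category B] [MonoidalCategory B]
variable {C : Type*} [Category C] [MonoidalCategory C]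

/-- The zero functor, constant at the unit object. -/
def zeroFunctor (A : Type*) [Category A] (C : Type*) [Category C] [MonoidalCategory C] : A ⥤ C :=
  (Functor.const A).obj (𝟙_ C)

@[simp] lemma zeroFunctor_obj (X : A) : (zeroFunctor A C).obj X = 𝟙_ C := rfl

@[simp] lemma zeroFunctor_map {X Y : A} (f : X ⟶ Y) : (zeroFunctor A C).map f = 𝟙 (𝟙_ C) := rfl

instance zeroFunctorMonoidal : (zeroFunctor A C).Monoidal where
  ε := 𝟙 (𝟙_ C)
  μ _ _ := (λ_ (𝟙_ C)).hom
  η := 𝟙 (𝟙_ C)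
  δ _ _ := (λ_ (𝟙_ C)).inv
  μ_natural_left _ _ := by simp
  μ_natural_right _ _ := by simp
  associativity _ _ _ := by simp; monoidal
  left_unitality _ := by simp
  right_unitality _ := by simp; monoidal
  δ_natural_left _ _ := by simp
  δ_natural_right _ _ := by simp
  oplax_associativity _ _ _ := by simp; monoidal
  oplax_left_unitality _ := by simp
  oplax_right_unitality _ := by simp; monoidal
  ε_η := by simp
  η_ε := by simp
  μ_δ _ _ := by simp
  δ_μ _ _ := by simp

@[simp] lemma zeroFunctor_ε : ε (zeroFunctor A C) = 𝟙 (𝟙_ C) := rfl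
@[simp] lemma zeroFunctor_η : η (zeroFunctor A C) = 𝟙 (𝟙_ C) := rfl
@[simp] lemma zeroFunctor_μ (X Y : A) : μ (zeroFunctor A C) X Y = (λ_ (𝟙_ C)).hom := rfl
@[simp] lemma zeroFunctor_δ (X Y : A) : δ (zeroFunctor A C) X Y = (λ_ (𝟙_ C)).inv := rfl

instance zeroFunctorBraided [BraidedCategory A] [BraidedCategory C] :
    (zeroFunctor A C).Braided where
  braided X Y := by
    simp [← unitors_equal]

lemma tensorμ_braiding [SymmetricCategory C] (X₁ X₂ Y₁ Y₂ : C) :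
    tensorμ X₁ X₂ Y₁ Y₂ ≫ ((β_ X₁ Y₁).hom ⊗ₘ (β_ X₂ Y₂).hom) =
      (β_ (X₁ ⊗ X₂) (Y₁ ⊗ Y₂)).hom ≫ tensorμ Y₁ Y₂ X₁ X₂ := by
  simp [tensorμ, SymmetricCategory.braiding_swap_eq_inv_braiding Y₂ X₁,
    MonoidalCategory.tensorHom_def]

/-- The pointwise sum `X ↦ F X ⊗ G X` of two functors. -/
def sumFunctor (F G : A ⥤ B) : A ⥤ B where
  obj X := F.obj X ⊗ G.obj X
  map f := F.map f ⊗ₘ G.map f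

@[simp] lemma sumFunctor_obj (F G : A ⥤ B) (X : A) :
    (sumFunctor F G).obj X = F.obj X ⊗ G.obj X := rfl

@[simp] lemma sumFunctor_map (F G : A ⥤ B) {X Y : A} (f : X ⟶ Y) :
    (sumFunctor F G).map f = F.map f ⊗ₘ G.map f := rfl

instance sumFunctorMonoidal [BraidedCategory B] (F G : A ⥤ B) [F.Monoidal] [G.Monoidal] :
    (sumFunctor F G).Monoidal :=
  Functor.Monoidal.copy (F := sumFunctor F G) (inferInstanceAs (Functor.prod' F G ⋙ tensor B).Monoidal)
    ((λ_ (𝟙_ B)).inv ≫ (ε F ⊗ₘ ε G))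
    (fun X Y ↦ tensorμ (F.obj X) (G.obj X) (F.obj Y) (G.obj Y) ≫ (μ F X Y ⊗ₘ μ G X Y))
    ((η F ⊗ₘ η G) ≫ (λ_ (𝟙_ B)).hom)
    (fun X Y ↦ (δ F X Y ⊗ₘ δ G X Y) ≫ tensorδ (F.obj X) (G.obj X) (F.obj Y) (G.obj Y))
    (show _ = ε (Functor.prod' F G ⋙ tensor B) by simp)
    (show _ = μ (Functor.prod' F G ⋙ tensor B) by ext; simp)
    (show _ = η (Functor.prod' F G ⋙ tensor B) by simp)
    (show _ = δ (Functor.prod' F G ⋙ tensor B) by ext; simp)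

lemma sumFunctor_μ [BraidedCategory B] (F G : A ⥤ B) [F.Monoidal] [G.Monoidal] (X Y : A) :
    μ (sumFunctor F G) X Y =
      tensorμ (F.obj X) (G.obj X) (F.obj Y) (G.obj Y) ≫ (μ F X Y ⊗ₘ μ G X Y) := rfl

lemma sumFunctor_δ [BraidedCategory B] (F G : A ⥤ B) [F.Monoidal] [G.Monoidal] (X Y : A) :
    δ (sumFunctor F G) X Y =
     (δ F X Y ⊗ₘ δ G X Y) ≫  tensorδ (F.obj X) (G.obj X) (F.obj Y) (G.obj Y) := rfl

instance sumFunctorBraided [BraidedCategory A] [SymmetricCategory B] (F G : A ⥤ B)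
    [F.Braided] [G.Braided] : (sumFunctor F G).Braided where
  braided X Y := by
    simp only [sumFunctor_μ, sumFunctor_map, sumFunctor_obj, Category.assoc,
      tensorHom_comp_tensorHom, Functor.LaxBraided.braided]
    rw [← tensorHom_comp_tensorHom, ← Category.assoc, tensorμ_braiding, Category.assoc]

lemma map_tensor_null (G : B ⥤ C) [G.Monoidal] {X Y : B} (f : X ⟶ 𝟙_ B) (g : Y ⟶ 𝟙_ B) :
    G.map (f ⊗ₘ g) ≫ G.map (λ_ (𝟙_ B)).hom ≫ η G =
      δ G _ _ ≫ (G.map f ≫ η G ⊗ₘ G.map g ≫ η G) ≫ (λ_ (𝟙_ C)).hom := by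
  rw [← left_unitality_hom, Category.assoc, Category.assoc, ← δ_natural_assoc,
    ← leftUnitor_naturality, tensorHom_def' (G.map f ≫ η G), comp_whiskerRight,
    MonoidalCategory.whiskerLeft_comp, tensorHom_def']
  simp only [Category.assoc, whisker_exchange_assoc]

/-- The component `G (F X) ⟶ 0` of a 2-cell `G ∘ F ⟶ 0`. -/
def nullApp {F : A ⥤ B} {G : B ⥤ C} (φ : F ⋙ G ⟶ zeroFunctor A C) (X : A) :
    G.obj (F.obj X) ⟶ 𝟙_ C :=
  φ.app X

section

variable {F : A ⥤ B} {G : B ⥤ C} (φ : F ⋙ G ⟶ zeroFunctor A C)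

@[simp]
lemma nullApp_naturality {X Y : A} (f : X ⟶ Y) :
    G.map (F.map f) ≫ nullApp φ Y = nullApp φ X :=
  (φ.naturality f).trans (Category.comp_id _)

variable [F.Monoidal] [G.Monoidal] [NatTrans.IsMonoidal φ]

lemma nullApp_unit : nullApp φ (𝟙_ A) = G.map (η F) ≫ η G := by
  have h : (ε G ≫ G.map (ε F)) ≫ nullApp φ (𝟙_ A) = 𝟙 (𝟙_ C) :=
    NatTrans.IsMonoidal.unit (τ := φ)
  rw [← cancel_epi (G.map (ε F)), ← cancel_epi (ε G), ← Category.assoc, h]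
  simp

lemma nullApp_tensor (X Y : A) :
    nullApp φ (X ⊗ Y) =
      G.map (δ F X Y) ≫ δ G _ _ ≫ (nullApp φ X ⊗ₘ nullApp φ Y) ≫ (λ_ (𝟙_ C)).hom := by
  have h : (μ G _ _ ≫ G.map (μ F X Y)) ≫ nullApp φ (X ⊗ Y) =
      (nullApp φ X ⊗ₘ nullApp φ Y) ≫ (λ_ (𝟙_ C)).hom :=
    NatTrans.IsMonoidal.tensor (τ := φ) X Y
  rw [← cancel_epi (G.map (μ F X Y)), ← cancel_epi (μ G _ _), ← Category.assoc, h]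
  simp

end

section

variable {A' : Type*} [Category A'] [MonoidalCategory A']
variable {B' : Type*} [Category B'] [MonoidalCategory B']
variable {F : A ⥤ B} {Q : B ⥤ B'} {P : A ⥤ A'} {F' : A' ⥤ B'} (σ : F ⋙ Q ⟶ P ⋙ F')

/-- The component `Q (F X) ⟶ F' (P X)` of a 2-cell filling a square. -/
def sqApp (X : A) : Q.obj (F.obj X) ⟶ F'.obj (P.obj X) :=
  σ.app X

lemma sqApp_naturality {X Y : A} (f : X ⟶ Y) :
    Q.map (F.map f) ≫ sqApp σ Y = sqApp σ X ≫ F'.map (P.map f) :=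
  σ.naturality f

variable [F.Monoidal] [Q.Monoidal] [P.Monoidal] [F'.Monoidal] [NatTrans.IsMonoidal σ]

lemma sqApp_unit : sqApp σ (𝟙_ A) ≫ F'.map (η P) ≫ η F' = Q.map (η F) ≫ η Q := by
  have h : (ε Q ≫ Q.map (ε F)) ≫ sqApp σ (𝟙_ A) = ε F' ≫ F'.map (ε P) :=
    NatTrans.IsMonoidal.unit (τ := σ)
  rw [← cancel_epi (Q.map (ε F)), ← cancel_epi (ε Q), ← Category.assoc, ← Category.assoc, h]
  simp

lemma sqApp_tensor_δ (X Y : A) :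
    sqApp σ (X ⊗ Y) ≫ F'.map (δ P X Y) ≫ δ F' _ _ =
      Q.map (δ F X Y) ≫ δ Q _ _ ≫ (sqApp σ X ⊗ₘ sqApp σ Y) := by
  have h : (μ Q _ _ ≫ Q.map (μ F X Y)) ≫ sqApp σ (X ⊗ Y) =
      (sqApp σ X ⊗ₘ sqApp σ Y) ≫ μ F' _ _ ≫ F'.map (μ P X Y) :=
    NatTrans.IsMonoidal.tensor (τ := σ) X Y
  rw [← cancel_epi (Q.map (μ F X Y)), ← cancel_epi (μ Q _ _), ← Category.assoc, ← Category.assoc, h]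
  simp

end

end Unbundled

/-! ### The relative kernel -/

section Kernel

variable {A : Type*} [Category A] [MonoidalCategory A]
variable {B : Type*} [Category B] [MonoidalCategory B]
variable {C : Type*} [Category C] [MonoidalCategory C]

/-- The relative kernel of a sequence `F : A ⥤ B`, `G : B ⥤ C`, `φ : F ⋙ G ⟶ 0`. Its objects are
the pairs `(X, a : F X ⟶ 0)` such that `G a` (followed by `G 0 ≅ 0`) is `φ_X`. -/
@[ext]
structure RelKer (F : A ⥤ B) (G : B ⥤ C) [G.Monoidal] (φ : F ⋙ G ⟶ zeroFunctor A C) where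
  obj : A
  arr : F.obj obj ⟶ 𝟙_ B
  w : G.map arr ≫ η G = nullApp φ obj

namespace RelKer

section

variable {F : A ⥤ B} {G : B ⥤ C} [G.Monoidal] {φ : F ⋙ G ⟶ zeroFunctor A C}

/-- A morphism `(X, a) ⟶ (Y, b)` is a morphism `f : X ⟶ Y` with `F f ≫ b = a`. -/
@[ext]
structure Hom (X Y : RelKer F G φ) where
  hom : X.obj ⟶ Y.obj
  w : F.map hom ≫ Y.arr = X.arr := by cat_disch

attribute [simp] Hom.w

instance : Category (RelKer F G φ) where
  Hom X Y := Hom X Y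
  id X := { hom := 𝟙 X.obj }
  comp f g := { hom := f.hom ≫ g.hom }

@[ext] lemma hom_ext {X Y : RelKer F G φ} {f g : X ⟶ Y} (h : f.hom = g.hom) : f = g := Hom.ext h

@[simp] lemma id_hom (X : RelKer F G φ) : Hom.hom (𝟙 X) = 𝟙 X.obj := rfl

@[simp] lemma comp_hom {X Y Z : RelKer F G φ} (f : X ⟶ Y) (g : Y ⟶ Z) :
    (f ≫ g).hom = f.hom ≫ g.hom := rfl

end

section Monoidal

variable {F : A ⥤ B} [F.Monoidal] {G : B ⥤ C} [G.Monoidal] {φ : F ⋙ G ⟶ zeroFunctor A C}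

/-- An isomorphism of the first components that is compatible with the second ones is an
isomorphism of the relative kernel. -/
@[simps]
def isoMk {X Y : RelKer F G φ} (e : X.obj ≅ Y.obj) (h : F.map e.hom ≫ Y.arr = X.arr) : X ≅ Y where
  hom := { hom := e.hom, w := h }
  inv := { hom := e.inv, w := by rw [← h, ← Functor.map_comp_assoc]; simp }

lemma δ_whiskerLeft_comp {X X' Y : A} {U V : B} (f : X ⟶ X') (a : F.obj Y ⟶ U)
    (b : F.obj X' ⟶ V) :
    F.map (Y ◁ f) ≫ δ F _ _ ≫ (a ⊗ₘ b) = δ F _ _ ≫ (a ⊗ₘ F.map f ≫ b) := by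
  rw [← δ_natural_right_assoc, ← id_tensorHom, tensorHom_comp_tensorHom, Category.id_comp]

lemma δ_whiskerRight_comp {X X' Y : A} {U V : B} (f : X ⟶ X') (a : F.obj Y ⟶ U)
    (b : F.obj X' ⟶ V) :
    F.map (f ▷ Y) ≫ δ F _ _ ≫ (b ⊗ₘ a) = δ F _ _ ≫ (F.map f ≫ b ⊗ₘ a) := by
  rw [← δ_natural_left_assoc, ← tensorHom_id, tensorHom_comp_tensorHom, Category.id_comp]

lemma δ_tensorHom_comp {X X' Y Y' : A} {U V : B} (f : X ⟶ X') (g : Y ⟶ Y') (a : F.obj Y' ⟶ U)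
    (b : F.obj X' ⟶ V) :
    F.map (f ⊗ₘ g) ≫ δ F _ _ ≫ (b ⊗ₘ a) = δ F _ _ ≫ (F.map f ≫ b ⊗ₘ F.map g ≫ a) := by
  rw [← δ_natural_assoc, tensorHom_comp_tensorHom]

lemma δ_associator_comp {X Y Z : A} (a : F.obj X ⟶ 𝟙_ B) (b : F.obj Y ⟶ 𝟙_ B)
    (c : F.obj Z ⟶ 𝟙_ B) :
    F.map (α_ X Y Z).hom ≫ δ F _ _ ≫
      (a ⊗ₘ (δ F _ _ ≫ (b ⊗ₘ c) ≫ (λ_ (𝟙_ B)).hom)) ≫ (λ_ (𝟙_ B)).hom =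
    δ F _ _ ≫ ((δ F _ _ ≫ (a ⊗ₘ b) ≫ (λ_ (𝟙_ B)).hom) ⊗ₘ c) ≫ (λ_ (𝟙_ B)).hom := by
  have h1 : (a ⊗ₘ (δ F Y Z ≫ (b ⊗ₘ c) ≫ (λ_ (𝟙_ B)).hom)) =
      F.obj X ◁ δ F Y Z ≫ (a ⊗ₘ (b ⊗ₘ c)) ≫ (𝟙_ B) ◁ (λ_ (𝟙_ B)).hom := by
    rw [← id_tensorHom, ← id_tensorHom, tensorHom_comp_tensorHom, tensorHom_comp_tensorHom,
      Category.comp_id, Category.id_comp]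
  have h2 : ((δ F X Y ≫ (a ⊗ₘ b) ≫ (λ_ (𝟙_ B)).hom) ⊗ₘ c) =
      δ F X Y ▷ F.obj Z ≫ ((a ⊗ₘ b) ⊗ₘ c) ≫ (λ_ (𝟙_ B)).hom ▷ (𝟙_ B) := by
    rw [← tensorHom_id, ← tensorHom_id, tensorHom_comp_tensorHom, tensorHom_comp_tensorHom,
      Category.comp_id, Category.id_comp]
  rw [h1, h2]
  simp only [Category.assoc]
  rw [← Functor.OplaxMonoidal.associativity_assoc, ← associator_naturality_assoc]
  congr 3
  monoidal

lemma δ_leftUnitor_comp {X : A} (a : F.obj X ⟶ 𝟙_ B) :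
    F.map (λ_ X).hom ≫ a = δ F _ _ ≫ (η F ⊗ₘ a) ≫ (λ_ (𝟙_ B)).hom := by
  rw [δ_comp_η_tensorHom_assoc, leftUnitor_naturality, Iso.inv_hom_id_assoc]

lemma δ_rightUnitor_comp {X : A} (a : F.obj X ⟶ 𝟙_ B) :
    F.map (ρ_ X).hom ≫ a = δ F _ _ ≫ (a ⊗ₘ η F) ≫ (λ_ (𝟙_ B)).hom := by
  rw [δ_comp_tensorHom_η_assoc, unitors_equal, rightUnitor_naturality, Iso.inv_hom_id_assoc]

variable [NatTrans.IsMonoidal φ]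

/-- The sum of two objects is `(X, a) + (Y, b) = (X + Y, F (X + Y) ≅ F X + F Y ⟶ 0 + 0 ≅ 0)`, the
zero object is `(0, F 0 ≅ 0)`; on morphisms everything is as in the source category. -/
instance : MonoidalCategoryStruct (RelKer F G φ) where
  tensorObj X Y :=
    { obj := X.obj ⊗ Y.obj
      arr := δ F _ _ ≫ (X.arr ⊗ₘ Y.arr) ≫ (λ_ (𝟙_ B)).hom
      w := by
        rw [nullApp_tensor, ← X.w, ← Y.w]
        simp only [Functor.map_comp, Category.assoc]
        rw [map_tensor_null] }
  tensorUnit :=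
    { obj := 𝟙_ A
      arr := η F
      w := (nullApp_unit φ).symm }
  whiskerLeft X _ _ f :=
    { hom := X.obj ◁ f.hom
      w := by rw [reassoc_of% @δ_whiskerLeft_comp, f.w] }
  whiskerRight f Y :=
    { hom := f.hom ▷ Y.obj
      w := by rw [reassoc_of% @δ_whiskerRight_comp, f.w] }
  tensorHom f g :=
    { hom := f.hom ⊗ₘ g.hom
      w := by rw [reassoc_of% @δ_tensorHom_comp, f.w, g.w] }
  associator X Y Z := isoMk (α_ X.obj Y.obj Z.obj) (δ_associator_comp _ _ _)
  leftUnitor X := isoMk (λ_ X.obj) (δ_leftUnitor_comp _)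
  rightUnitor X := isoMk (ρ_ X.obj) (δ_rightUnitor_comp _)

@[simp] lemma tensorObj_obj (X Y : RelKer F G φ) : (X ⊗ Y).obj = X.obj ⊗ Y.obj := rfl
@[simp] lemma tensorObj_arr (X Y : RelKer F G φ) :
    (X ⊗ Y).arr = δ F _ _ ≫ (X.arr ⊗ₘ Y.arr) ≫ (λ_ (𝟙_ B)).hom := rfl
@[simp] lemma tensorUnit_obj : (𝟙_ (RelKer F G φ)).obj = 𝟙_ A := rfl
@[simp] lemma tensorUnit_arr : (𝟙_ (RelKer F G φ)).arr = η F := rfl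
@[simp] lemma whiskerLeft_hom (X : RelKer F G φ) {Y Z : RelKer F G φ} (f : Y ⟶ Z) :
    (X ◁ f).hom = X.obj ◁ f.hom := rfl
@[simp] lemma whiskerRight_hom {X Y : RelKer F G φ} (f : X ⟶ Y) (Z : RelKer F G φ) :
    (f ▷ Z).hom = f.hom ▷ Z.obj := rfl
@[simp] lemma tensorHom_hom {X Y X' Y' : RelKer F G φ} (f : X ⟶ Y) (g : X' ⟶ Y') :
    (f ⊗ₘ g).hom = f.hom ⊗ₘ g.hom := rfl
@[simp] lemma associator_hom_hom (X Y Z : RelKer F G φ) :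
    (α_ X Y Z).hom.hom = (α_ X.obj Y.obj Z.obj).hom := rfl
@[simp] lemma associator_inv_hom (X Y Z : RelKer F G φ) :
    (α_ X Y Z).inv.hom = (α_ X.obj Y.obj Z.obj).inv := rfl
@[simp] lemma leftUnitor_hom_hom (X : RelKer F G φ) : (λ_ X).hom.hom = (λ_ X.obj).hom := rfl
@[simp] lemma leftUnitor_inv_hom (X : RelKer F G φ) : (λ_ X).inv.hom = (λ_ X.obj).inv := rfl
@[simp] lemma rightUnitor_hom_hom (X : RelKer F G φ) : (ρ_ X).hom.hom = (ρ_ X.obj).hom := rfl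
@[simp] lemma rightUnitor_inv_hom (X : RelKer F G φ) : (ρ_ X).inv.hom = (ρ_ X.obj).inv := rfl

instance : MonoidalCategory (RelKer F G φ) where
  tensorHom_def _ _ := hom_ext (MonoidalCategory.tensorHom_def _ _)
  id_tensorHom_id _ _ := by ext; simp
  tensorHom_comp_tensorHom _ _ _ _ := by ext; simp
  whiskerLeft_id _ _ := by ext; simp
  id_whiskerRight _ _ := by ext; simp
  associator_naturality _ _ _ := by ext; simp
  leftUnitor_naturality _ := by ext; simp
  rightUnitor_naturality _ := by ext; simp
  pentagon _ _ _ _ := by ext; simp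
  triangle _ _ := by ext; simp

end Monoidal

section Symmetric

variable [SymmetricCategory A] [SymmetricCategory B]
variable {F : A ⥤ B} [F.Braided] {G : B ⥤ C} [G.Monoidal] {φ : F ⋙ G ⟶ zeroFunctor A C}
variable [NatTrans.IsMonoidal φ]

lemma map_braiding_comp {X Y : A} (a : F.obj X ⟶ 𝟙_ B) (b : F.obj Y ⟶ 𝟙_ B) :
    F.map (β_ X Y).hom ≫ δ F _ _ ≫ (b ⊗ₘ a) ≫ (λ_ (𝟙_ B)).hom =
      δ F _ _ ≫ (a ⊗ₘ b) ≫ (λ_ (𝟙_ B)).hom := by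
  rw [Functor.map_braiding]
  simp [← BraidedCategory.braiding_naturality_assoc, ← unitors_equal]

instance : SymmetricCategory (RelKer F G φ) where
  braiding X Y := isoMk (β_ X.obj Y.obj) (map_braiding_comp _ _)
  braiding_naturality_left f Z := hom_ext (BraidedCategory.braiding_naturality_left f.hom Z.obj)
  braiding_naturality_right X _ _ f :=
    hom_ext (BraidedCategory.braiding_naturality_right X.obj f.hom)
  hexagon_forward X Y Z := hom_ext (BraidedCategory.hexagon_forward X.obj Y.obj Z.obj)
  hexagon_reverse X Y Z := hom_ext (BraidedCategory.hexagon_reverse X.obj Y.obj Z.obj)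
  symmetry X Y := hom_ext (SymmetricCategory.symmetry X.obj Y.obj)

@[simp] lemma braiding_hom_hom (X Y : RelKer F G φ) : (β_ X Y).hom.hom = (β_ X.obj Y.obj).hom := rfl

end Symmetric

section TwoGroup

variable [IsTwoGroup A] [IsTwoGroup B]
variable {F : A ⥤ B} [F.Monoidal] {G : B ⥤ C} [G.Monoidal] {φ : F ⋙ G ⟶ zeroFunctor A C}
variable [NatTrans.IsMonoidal φ]

instance : IsTwoGroup (RelKer F G φ) where
  all_isIso f := (isoMk (asIso f.hom) f.w).isIso_hom
  exists_inverse X := by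
    obtain ⟨Y, ⟨e⟩⟩ := IsTwoGroup.exists_inverse X.obj
    let b : F.obj Y ⟶ 𝟙_ B :=
      (λ_ _).inv ≫ inv X.arr ▷ F.obj Y ≫ μ F _ _ ≫ F.map e.hom ≫ η F
    have hb : δ F X.obj Y ≫ (X.arr ⊗ₘ b) ≫ (λ_ (𝟙_ B)).hom = F.map e.hom ≫ η F := by
      rw [MonoidalCategory.tensorHom_def, Category.assoc, leftUnitor_naturality]
      dsimp only [b]
      rw [Iso.hom_inv_id_assoc, ← comp_whiskerRight_assoc, IsIso.hom_inv_id, id_whiskerRight,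
        Category.id_comp, δ_μ_assoc]
    have h1 : nullApp φ (X.obj ⊗ Y) = G.map (δ F X.obj Y) ≫ δ G _ _ ≫
        (nullApp φ X.obj ⊗ₘ (G.map b ≫ η G)) ≫ (λ_ (𝟙_ C)).hom := by
      rw [← nullApp_naturality φ e.hom, nullApp_unit, ← Functor.map_comp_assoc, ← hb, ← X.w]
      simp only [Functor.map_comp, Category.assoc]
      rw [map_tensor_null]
    rw [nullApp_tensor, cancel_epi, cancel_epi, cancel_mono, MonoidalCategory.tensorHom_def,
      MonoidalCategory.tensorHom_def, ← X.w, cancel_epi] at h1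
    have h2 : G.map b ≫ η G = nullApp φ Y := ((whiskerLeft_iff _ _).1 h1).symm
    exact ⟨{ obj := Y, arr := b, w := h2 }, ⟨isoMk e hb.symm⟩⟩

end TwoGroup

/-! #### Functors into and between relative kernels -/

section Lift

variable {Z : Type*} [Category Z] [MonoidalCategory Z]

section

variable {F : A ⥤ B} {G : B ⥤ C} [G.Monoidal] (φ : F ⋙ G ⟶ zeroFunctor A C)
  (K : Z ⥤ A) (ψ : K ⋙ F ⟶ zeroFunctor Z B)
  (h : ∀ X : Z, G.map (nullApp ψ X) ≫ η G = nullApp φ (K.obj X))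

/-- The factorization `X ↦ (K X, ψ_X)` through the relative kernel of a functor `K` with a 2-cell
`ψ : F ∘ K ⟶ 0` that is compatible with `φ`. -/
@[simps]
def lift : Z ⥤ RelKer F G φ where
  obj X := { obj := K.obj X, arr := nullApp ψ X, w := h X }
  map f := { hom := K.map f, w := nullApp_naturality ψ f }

end

variable {F : A ⥤ B} [F.Monoidal] {G : B ⥤ C} [G.Monoidal] (φ : F ⋙ G ⟶ zeroFunctor A C)
  [NatTrans.IsMonoidal φ] (K : Z ⥤ A) (ψ : K ⋙ F ⟶ zeroFunctor Z B)
  (h : ∀ X : Z, G.map (nullApp ψ X) ≫ η G = nullApp φ (K.obj X))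

section

variable [K.Monoidal] [NatTrans.IsMonoidal ψ]

lemma lift_ε_w : F.map (ε K) ≫ nullApp ψ (𝟙_ Z) = η F := by
  rw [nullApp_unit, map_ε_η_assoc]

lemma lift_μ_w (X Y : Z) : F.map (μ K X Y) ≫ nullApp ψ (X ⊗ Y) =
    δ F _ _ ≫ (nullApp ψ X ⊗ₘ nullApp ψ Y) ≫ (λ_ (𝟙_ B)).hom := by
  rw [nullApp_tensor, map_μ_δ_assoc]

end

instance [K.Monoidal] [NatTrans.IsMonoidal ψ] : (lift φ K ψ h).Monoidal :=
  Functor.CoreMonoidal.toMonoidal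
    { εIso := isoMk (εIso K) (lift_ε_w K ψ)
      μIso := fun X Y ↦ isoMk (μIso K X Y) (lift_μ_w K ψ X Y)
      μIso_hom_natural_left := fun f Z ↦ hom_ext (μ_natural_left K f Z)
      μIso_hom_natural_right := fun X f ↦ hom_ext (μ_natural_right K X f)
      associativity := fun X Y Z ↦ hom_ext (Functor.LaxMonoidal.associativity K X Y Z)
      left_unitality := fun X ↦ hom_ext (Functor.LaxMonoidal.left_unitality K X)
      right_unitality := fun X ↦ hom_ext (Functor.LaxMonoidal.right_unitality K X) }

@[simp] lemma lift_ε_hom [K.Monoidal] [NatTrans.IsMonoidal ψ] :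
    (ε (lift φ K ψ h)).hom = ε K := rfl
@[simp] lemma lift_η_hom [K.Monoidal] [NatTrans.IsMonoidal ψ] :
    (η (lift φ K ψ h)).hom = η K := rfl
@[simp] lemma lift_μ_hom [K.Monoidal] [NatTrans.IsMonoidal ψ] (X Y : Z) :
    (μ (lift φ K ψ h) X Y).hom = μ K X Y := rfl
@[simp] lemma lift_δ_hom [K.Monoidal] [NatTrans.IsMonoidal ψ] (X Y : Z) :
    (δ (lift φ K ψ h) X Y).hom = δ K X Y := rfl

end Lift

section Map

variable {A' : Type*} [Category A'] [MonoidalCategory A']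
variable {B' : Type*} [Category B'] [MonoidalCategory B'] [IsGroupoid B']
variable {C' : Type*} [Category C'] [MonoidalCategory C'] [IsGroupoid C']
variable {F : A ⥤ B} [F.Monoidal] {G : B ⥤ C} [G.Monoidal] {φ : F ⋙ G ⟶ zeroFunctor A C}
variable {F' : A' ⥤ B'} [F'.Monoidal] {G' : B' ⥤ C'} [G'.Monoidal]
  {φ' : F' ⋙ G' ⟶ zeroFunctor A' C'}
variable (P : A ⥤ A') (Q : B ⥤ B') [Q.Monoidal] (R : C ⥤ C') [R.Monoidal]
  (σ : F ⋙ Q ⟶ P ⋙ F') (ρ : G ⋙ R ⟶ Q ⋙ G') [NatTrans.IsMonoidal ρ]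
  (h : ∀ X : A, sqApp ρ (F.obj X) ≫ G'.map (sqApp σ X) ≫ nullApp φ' (P.obj X) =
    R.map (nullApp φ X) ≫ η R)

lemma map_w (X : RelKer F G φ)
    (h1 : sqApp ρ (F.obj X.obj) ≫ G'.map (sqApp σ X.obj) ≫ nullApp φ' (P.obj X.obj) =
      R.map (nullApp φ X.obj) ≫ η R) :
    G'.map (inv (sqApp σ X.obj) ≫ Q.map X.arr ≫ η Q) ≫ η G' = nullApp φ' (P.obj X.obj) := by
  rw [← X.w, Functor.map_comp, Category.assoc, ← sqApp_unit ρ, reassoc_of% @sqApp_naturality,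
    cancel_epi] at h1
  rw [← cancel_epi (G'.map (sqApp σ X.obj)), h1, ← Functor.map_comp_assoc,
    IsIso.hom_inv_id_assoc, Functor.map_comp, Category.assoc]

lemma map_hom_w {X Y : RelKer F G φ} (f : X ⟶ Y) :
    F'.map (P.map f.hom) ≫ inv (sqApp σ Y.obj) ≫ Q.map Y.arr ≫ η Q =
      inv (sqApp σ X.obj) ≫ Q.map X.arr ≫ η Q := by
  rw [← cancel_epi (sqApp σ X.obj), ← reassoc_of% @sqApp_naturality, IsIso.hom_inv_id_assoc,
    IsIso.hom_inv_id_assoc, ← Functor.map_comp_assoc, f.w]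

/-- The functor induced on relative kernels, given on objects by
`(X, a) ↦ (P X, F' (P X) ≅ Q (F X) ⟶ Q 0 ≅ 0)` and on morphisms by `f ↦ P f`. -/
@[simps]
noncomputable def map : RelKer F G φ ⥤ RelKer F' G' φ' where
  obj X :=
    { obj := P.obj X.obj
      arr := inv (sqApp σ X.obj) ≫ Q.map X.arr ≫ η Q
      w := map_w P Q R σ ρ X (h X.obj) }
  map f :=
    { hom := P.map f.hom
      w := map_hom_w P Q σ f }

variable [NatTrans.IsMonoidal φ] [NatTrans.IsMonoidal φ'] [P.Monoidal] [NatTrans.IsMonoidal σ]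

lemma map_ε_w : F'.map (ε P) ≫ inv (sqApp σ (𝟙_ A)) ≫ Q.map (η F) ≫ η Q = η F' := by
  rw [← sqApp_unit σ, IsIso.inv_hom_id_assoc, map_ε_η_assoc]

lemma map_μ_inv_sqApp (X Y : A) :
    F'.map (μ P X Y) ≫ inv (sqApp σ (X ⊗ Y)) ≫ Q.map (δ F X Y) ≫ δ Q _ _ =
      δ F' _ _ ≫ (inv (sqApp σ X) ⊗ₘ inv (sqApp σ Y)) := by
  rw [← cancel_mono (sqApp σ X ⊗ₘ sqApp σ Y)]
  simp only [Category.assoc]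
  rw [← sqApp_tensor_δ σ, IsIso.inv_hom_id_assoc, map_μ_δ_assoc, tensorHom_comp_tensorHom,
    IsIso.inv_hom_id, IsIso.inv_hom_id, id_tensorHom_id, Category.comp_id]

lemma map_μ_w {X Y : A} (a : F.obj X ⟶ 𝟙_ B) (b : F.obj Y ⟶ 𝟙_ B) :
    F'.map (μ P X Y) ≫ inv (sqApp σ (X ⊗ Y)) ≫
        Q.map (δ F X Y ≫ (a ⊗ₘ b) ≫ (λ_ (𝟙_ B)).hom) ≫ η Q =
      δ F' _ _ ≫ (inv (sqApp σ X) ≫ Q.map a ≫ η Q ⊗ₘ inv (sqApp σ Y) ≫ Q.map b ≫ η Q) ≫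
        (λ_ (𝟙_ B')).hom := by
  simp only [Functor.map_comp, Category.assoc]
  rw [map_tensor_null, ← tensorHom_comp_tensorHom (inv (sqApp σ X)) (inv (sqApp σ Y)),
    Category.assoc, reassoc_of% @map_μ_inv_sqApp]

noncomputable instance : (map P Q R σ ρ h).Monoidal :=
  Functor.CoreMonoidal.toMonoidal
    { εIso := isoMk (εIso P) (map_ε_w P Q σ)
      μIso := fun X Y ↦ isoMk (μIso P X.obj Y.obj) (map_μ_w P Q σ X.arr Y.arr)
      μIso_hom_natural_left := fun f Z ↦ hom_ext (μ_natural_left P f.hom Z.obj)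
      μIso_hom_natural_right := fun X f ↦ hom_ext (μ_natural_right P X.obj f.hom)
      associativity := fun X Y Z ↦
        hom_ext (Functor.LaxMonoidal.associativity P X.obj Y.obj Z.obj)
      left_unitality := fun X ↦ hom_ext (Functor.LaxMonoidal.left_unitality P X.obj)
      right_unitality := fun X ↦ hom_ext (Functor.LaxMonoidal.right_unitality P X.obj) }

@[simp] lemma map_ε_hom : (ε (map P Q R σ ρ h)).hom = ε P := rfl
@[simp] lemma map_η_hom : (η (map P Q R σ ρ h)).hom = η P := rfl
@[simp] lemma map_μ_hom (X Y : RelKer F G φ) :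
    (μ (map P Q R σ ρ h) X Y).hom = μ P X.obj Y.obj := rfl
@[simp] lemma map_δ_hom (X Y : RelKer F G φ) :
    (δ (map P Q R σ ρ h) X Y).hom = δ P X.obj Y.obj := rfl

end Map

section BraidedFunctors

variable [SymmetricCategory A] [SymmetricCategory B]

instance {Z : Type*} [Category Z] [MonoidalCategory Z] [SymmetricCategory Z]
    {F : A ⥤ B} [F.Braided] {G : B ⥤ C} [G.Monoidal] (φ : F ⋙ G ⟶ zeroFunctor A C)
    [NatTrans.IsMonoidal φ] (K : Z ⥤ A) [K.Braided] (ψ : K ⋙ F ⟶ zeroFunctor Z B)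
    [NatTrans.IsMonoidal ψ]
    (h : ∀ X : Z, G.map (nullApp ψ X) ≫ η G = nullApp φ (K.obj X)) :
    (lift φ K ψ h).Braided where
  braided X Y := hom_ext (Functor.LaxBraided.braided X Y)

variable {A' : Type*} [Category A'] [MonoidalCategory A'] [SymmetricCategory A']
variable {B' : Type*} [Category B'] [MonoidalCategory B'] [SymmetricCategory B'] [IsGroupoid B']
variable {C' : Type*} [Category C'] [MonoidalCategory C'] [IsGroupoid C']
variable {F : A ⥤ B} [F.Braided] {G : B ⥤ C} [G.Monoidal] {φ : F ⋙ G ⟶ zeroFunctor A C}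
variable {F' : A' ⥤ B'} [F'.Braided] {G' : B' ⥤ C'} [G'.Monoidal]
  {φ' : F' ⋙ G' ⟶ zeroFunctor A' C'}
variable (P : A ⥤ A') (Q : B ⥤ B') [Q.Monoidal] (R : C ⥤ C') [R.Monoidal]
  (σ : F ⋙ Q ⟶ P ⋙ F') (ρ : G ⋙ R ⟶ Q ⋙ G') [NatTrans.IsMonoidal ρ]
  (h : ∀ X : A, sqApp ρ (F.obj X) ≫ G'.map (sqApp σ X) ≫ nullApp φ' (P.obj X) =
    R.map (nullApp φ X) ≫ η R)
variable [NatTrans.IsMonoidal φ] [NatTrans.IsMonoidal φ'] [P.Braided] [NatTrans.IsMonoidal σ]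

noncomputable instance : (map P Q R σ ρ h).Braided where
  braided X Y := hom_ext (Functor.LaxBraided.braided X.obj Y.obj)

end BraidedFunctors

end RelKer

end Kernel

/-! ### The relative cokernel -/

section Swap

variable {C : Type*} [Category C] [MonoidalCategory C] [BraidedCategory C]

/-- The canonical morphism `X + (Y + Z) ⟶ Y + (X + Z)`. -/
def swapLeft (X Y Z : C) : X ⊗ (Y ⊗ Z) ⟶ Y ⊗ (X ⊗ Z) :=
  (α_ X Y Z).inv ≫ (β_ X Y).hom ▷ Z ≫ (α_ Y X Z).hom

lemma swapLeft_natural_left {X X' : C} (f : X ⟶ X') (Y Z : C) :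
    f ▷ (Y ⊗ Z) ≫ swapLeft X' Y Z = swapLeft X Y Z ≫ Y ◁ f ▷ Z := by
  simp only [swapLeft, Category.assoc]
  rw [associator_inv_naturality_left_assoc, ← comp_whiskerRight_assoc,
    BraidedCategory.braiding_naturality_left, comp_whiskerRight_assoc,
    associator_naturality_middle]

lemma swapLeft_natural_mid (X : C) {Y Y' : C} (f : Y ⟶ Y') (Z : C) :
    X ◁ f ▷ Z ≫ swapLeft X Y' Z = swapLeft X Y Z ≫ f ▷ (X ⊗ Z) := by
  simp only [swapLeft, Category.assoc]
  rw [associator_inv_naturality_middle_assoc, ← comp_whiskerRight_assoc,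
    BraidedCategory.braiding_naturality_right, comp_whiskerRight_assoc,
    associator_naturality_left]

lemma swapLeft_natural_right (X Y : C) {Z Z' : C} (f : Z ⟶ Z') :
    X ◁ Y ◁ f ≫ swapLeft X Y Z' = swapLeft X Y Z ≫ Y ◁ X ◁ f := by
  simp only [swapLeft, Category.assoc]
  rw [associator_inv_naturality_right_assoc, whisker_exchange_assoc, associator_naturality_right]

lemma swapLeft_unit_mid (X Y : C) :
    swapLeft X (𝟙_ C) Y ≫ (λ_ (X ⊗ Y)).hom = X ◁ (λ_ Y).hom := by
  simp [swapLeft, braiding_tensorUnit_right]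

lemma swapLeft_unit_mid_inv (X Y : C) :
    X ◁ (λ_ Y).inv ≫ swapLeft X (𝟙_ C) Y = (λ_ (X ⊗ Y)).inv := by
  rw [← cancel_mono (λ_ (X ⊗ Y)).hom, Category.assoc, swapLeft_unit_mid, ← whiskerLeft_comp,
    Iso.inv_hom_id, Iso.inv_hom_id, whiskerLeft_id]

lemma swapLeft_unit_left (X Y : C) :
    swapLeft (𝟙_ C) X Y ≫ X ◁ (λ_ Y).hom = (λ_ (X ⊗ Y)).hom := by
  simp [swapLeft, braiding_tensorUnit_left]

lemma swapLeft_tensor_mid (X Y Y' Z : C) :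
    X ◁ (α_ Y Y' Z).inv ≫ swapLeft X (Y ⊗ Y') Z =
      swapLeft X Y (Y' ⊗ Z) ≫ Y ◁ swapLeft X Y' Z ≫ (α_ Y Y' (X ⊗ Z)).inv := by
  simp [swapLeft]

lemma swapLeft_tensor_left (X X' Y Z : C) :
    swapLeft (X ⊗ X') Y Z ≫ Y ◁ (α_ X X' Z).hom =
      (α_ X X' (Y ⊗ Z)).hom ≫ X ◁ swapLeft X' Y Z ≫ swapLeft X Y (X' ⊗ Z) := by
  simp [swapLeft]

lemma swapLeft_tensor_right (X Y Z Z' : C) :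
    swapLeft X Y Z ▷ Z' ≫ (α_ Y (X ⊗ Z) Z').hom ≫ Y ◁ (α_ X Z Z').hom =
      (α_ X (Y ⊗ Z) Z').hom ≫ X ◁ (α_ Y Z Z').hom ≫ swapLeft X Y (Z ⊗ Z') := by
  simp [swapLeft]

lemma map_swapLeft {B : Type*} [Category B] [MonoidalCategory B] [BraidedCategory B]
    (G : B ⥤ C) [G.Braided] (X Y Z : B) :
    G.obj X ◁ μ G Y Z ≫ μ G X (Y ⊗ Z) ≫ G.map (swapLeft X Y Z) =
      swapLeft (G.obj X) (G.obj Y) (G.obj Z) ≫ G.obj Y ◁ μ G X Z ≫ μ G Y (X ⊗ Z) := by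
  simp only [swapLeft, Functor.map_comp, Category.assoc]
  rw [whiskerLeft_μ_comp_μ_assoc, ← G.map_comp_assoc, Iso.hom_inv_id, CategoryTheory.Functor.map_id,
    Category.id_comp, ← μ_natural_left_assoc, ← comp_whiskerRight_assoc,
    Functor.LaxBraided.braided, comp_whiskerRight_assoc, Functor.LaxMonoidal.associativity]

end Swap

section Collapse

variable {A : Type*} [Category A] [MonoidalCategory A]
variable {B : Type*} [Category B] [MonoidalCategory B]
variable {C : Type*} [Category C] [MonoidalCategory C]
variable {F : A ⥤ B} {G : B ⥤ C} [G.Monoidal] (φ : F ⋙ G ⟶ zeroFunctor A C)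

/-- The morphism `G (F a + b) ≅ G (F a) + G b ⟶ 0 + G b ≅ G b` given by `φ_a`. -/
def collapse (a : A) (b : B) : G.obj (F.obj a ⊗ b) ⟶ G.obj b :=
  δ G _ _ ≫ nullApp φ a ▷ G.obj b ≫ (λ_ (G.obj b)).hom

lemma μ_collapse (a : A) (b : B) :
    μ G _ _ ≫ collapse φ a b = nullApp φ a ▷ G.obj b ≫ (λ_ (G.obj b)).hom := by
  simp only [collapse, μ_δ_assoc]

lemma collapse_natural (a : A) {b b' : B} (f : b ⟶ b') :
    G.map (F.obj a ◁ f) ≫ collapse φ a b' = collapse φ a b ≫ G.map f := by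
  simp only [collapse, ← δ_natural_right_assoc, Category.assoc, ← leftUnitor_naturality,
    whisker_exchange_assoc]

lemma collapse_tensor (a : A) (b b' : B) :
    μ G (F.obj a ⊗ b) b' ≫ G.map (α_ _ _ _).hom ≫ collapse φ a (b ⊗ b') =
      collapse φ a b ▷ G.obj b' ≫ μ G b b' := by
  rw [← cancel_epi (μ G (F.obj a) b ▷ G.obj b'), Functor.LaxMonoidal.associativity_assoc,
    μ_collapse, ← comp_whiskerRight_assoc, μ_collapse, whisker_exchange_assoc,
    leftUnitor_naturality]
  simp [-Functor.LaxMonoidal.left_unitality]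

lemma collapse_swapLeft [BraidedCategory B] [BraidedCategory C] {G : B ⥤ C} [G.Braided]
    (φ : F ⋙ G ⟶ zeroFunctor A C) (a : A) (b b' : B) :
    μ G b (F.obj a ⊗ b') ≫ G.map (swapLeft _ _ _) ≫ collapse φ a (b ⊗ b') =
      G.obj b ◁ collapse φ a b' ≫ μ G b b' := by
  rw [← cancel_epi (G.obj b ◁ μ G (F.obj a) b'), reassoc_of% @map_swapLeft, μ_collapse,
    ← whiskerLeft_comp_assoc, μ_collapse, whisker_exchange_assoc,
    leftUnitor_naturality, ← reassoc_of% @swapLeft_natural_mid, reassoc_of% @swapLeft_unit_mid]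
  simp [-Functor.LaxMonoidal.left_unitality]

lemma collapse_unit [F.Monoidal] [NatTrans.IsMonoidal φ] (b : B) :
    G.map ((λ_ b).inv ≫ ε F ▷ b) ≫ collapse φ (𝟙_ A) b = 𝟙 (G.obj b) := by
  rw [collapse, nullApp_unit, Functor.map_comp, Category.assoc, ← δ_natural_left_assoc,
    ← comp_whiskerRight_assoc, map_ε_η_assoc, left_unitality_hom, ← Functor.map_comp,
    Iso.inv_hom_id, CategoryTheory.Functor.map_id]

end Collapse

section Cokernel

variable {A : Type*} [Category A] [MonoidalCategory A]
variable {B : Type*} [Category B] [MonoidalCategory B]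
variable {C : Type*} [Category C] [MonoidalCategory C]

/-- The relative cokernel of a sequence `F : A ⥤ B`, `G : B ⥤ C`, `φ : F ⋙ G ⟶ 0`. It has the same
objects as `C`. -/
@[ext]
structure RelCoker (F : A ⥤ B) (G : B ⥤ C) (φ : F ⋙ G ⟶ zeroFunctor A C) where
  obj : C

namespace RelCoker

/-- A representative `(b, f : X ⟶ G b + Y)` of a morphism `X ⟶ Y` of the relative cokernel. -/
structure PreHom (G : B ⥤ C) (X Y : C) where
  obj : B
  arr : X ⟶ G.obj obj ⊗ Y

/-- `(b, f)` and `(b', f')` represent the same morphism if there are `a` in `A` and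
`t : b ⟶ F a + b'` such that `X ⟶ G b + Y ⟶ G (F a + b') + Y ⟶ G b' + Y` is `f'`. -/
def PreHom.Rel {F : A ⥤ B} {G : B ⥤ C} [G.Monoidal] (φ : F ⋙ G ⟶ zeroFunctor A C) {X Y : C}
    (f g : PreHom G X Y) : Prop :=
  ∃ (a : A) (t : f.obj ⟶ F.obj a ⊗ g.obj), f.arr ≫ (G.map t ≫ collapse φ a g.obj) ▷ Y = g.arr

section Category

variable {F : A ⥤ B} {G : B ⥤ C} [G.Monoidal] {φ : F ⋙ G ⟶ zeroFunctor A C}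

/-- The set of morphisms `X ⟶ Y` of the relative cokernel. The quotient is by the equivalence
relation generated by `PreHom.Rel`; for symmetric 2-groups this relation already is an equivalence
relation. -/
def Hom (X Y : RelCoker F G φ) : Type _ := Quot (PreHom.Rel φ (X := X.obj) (Y := Y.obj))

/-- The composite `X ⟶ G b + Y ⟶ G b + (G b' + Z) ≅ G (b + b') + Z` of representatives. -/
def PreHom.comp {X Y Z : C} (f : PreHom G X Y) (g : PreHom G Y Z) : PreHom G X Z where
  obj := f.obj ⊗ g.obj
  arr := f.arr ≫ G.obj f.obj ◁ g.arr ≫ (α_ _ _ _).inv ≫ μ G f.obj g.obj ▷ Z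

/-- The representative `(0, X ≅ 0 + X ≅ G 0 + X ≅ G 0 + Y)` of the class of a morphism of `C`. -/
def PreHom.of {X Y : C} (f : X ⟶ Y) : PreHom G X Y where
  obj := 𝟙_ B
  arr := f ≫ (λ_ Y).inv ≫ ε G ▷ Y

lemma PreHom.comp_rel_left {X Y Z : C} {f f' : PreHom G X Y} (h : PreHom.Rel φ f f')
    (g : PreHom G Y Z) : PreHom.Rel φ (f.comp g) (f'.comp g) := by
  obtain ⟨a, t, ht⟩ := h
  refine ⟨a, t ▷ g.obj ≫ (α_ _ _ _).hom, ?_⟩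
  simp only [PreHom.comp, Functor.map_comp, Category.assoc, ← ht]
  rw [← comp_whiskerRight, ← μ_natural_left_assoc, collapse_tensor, ← comp_whiskerRight_assoc,
    comp_whiskerRight, ← associator_inv_naturality_left_assoc, whisker_exchange_assoc]

lemma PreHom.comp_rel_right [BraidedCategory B] [BraidedCategory C] {G : B ⥤ C} [G.Braided]
    {φ : F ⋙ G ⟶ zeroFunctor A C} {X Y Z : C} (f : PreHom G X Y) {g g' : PreHom G Y Z}
    (h : PreHom.Rel φ g g') : PreHom.Rel φ (f.comp g) (f.comp g') := by
  obtain ⟨a, t, ht⟩ := h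
  refine ⟨a, f.obj ◁ t ≫ swapLeft _ _ _, ?_⟩
  simp only [PreHom.comp, Functor.map_comp, Category.assoc, ← ht]
  rw [← comp_whiskerRight, ← μ_natural_right_assoc, collapse_swapLeft]
  simp

lemma PreHom.rel_of_hom [F.Monoidal] [NatTrans.IsMonoidal φ] {X Y : C} {f g : PreHom G X Y}
    (t : f.obj ⟶ g.obj) (ht : f.arr ≫ G.map t ▷ Y = g.arr) : PreHom.Rel φ f g := by
  refine ⟨𝟙_ A, t ≫ (λ_ _).inv ≫ ε F ▷ g.obj, ?_⟩
  rw [Functor.map_comp, Category.assoc, collapse_unit, Category.comp_id, ht]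

lemma PreHom.of_comp [F.Monoidal] [NatTrans.IsMonoidal φ] {X Y Z : C} (f : X ⟶ Y)
    (g : PreHom G Y Z) :
    PreHom.Rel φ ((PreHom.of f).comp g) { obj := g.obj, arr := f ≫ g.arr } := by
  refine PreHom.rel_of_hom (λ_ g.obj).hom ?_
  simp only [PreHom.comp, PreHom.of, Category.assoc]
  rw [← comp_whiskerRight, ← whisker_exchange_assoc,
    associator_inv_naturality_left_assoc, ← comp_whiskerRight,
    ← Functor.LaxMonoidal.left_unitality]
  simp [-Functor.LaxMonoidal.left_unitality]

lemma PreHom.comp_of [F.Monoidal] [NatTrans.IsMonoidal φ] {X Y Z : C} (f : PreHom G X Y)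
    (g : Y ⟶ Z) :
    PreHom.Rel φ (f.comp (PreHom.of g)) { obj := f.obj, arr := f.arr ≫ G.obj f.obj ◁ g } := by
  refine PreHom.rel_of_hom (ρ_ f.obj).hom ?_
  simp only [PreHom.comp, PreHom.of, MonoidalCategory.whiskerLeft_comp, Category.assoc]
  rw [associator_inv_naturality_middle_assoc, ← comp_whiskerRight, ← comp_whiskerRight,
    ← Functor.LaxMonoidal.right_unitality]
  simp [-Functor.LaxMonoidal.right_unitality]

end Category

section

variable [BraidedCategory B] [BraidedCategory C]
  {F : A ⥤ B} [F.Monoidal] {G : B ⥤ C} [G.Braided] {φ : F ⋙ G ⟶ zeroFunctor A C}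

variable [NatTrans.IsMonoidal φ]

instance : Category (RelCoker F G φ) where
  Hom X Y := Hom X Y
  id X := Quot.mk _ (PreHom.of (𝟙 X.obj))
  comp f g := Quot.map₂ PreHom.comp (fun f _ _ h ↦ PreHom.comp_rel_right f h)
    (fun _ _ g h ↦ PreHom.comp_rel_left h g) f g
  id_comp := by
    rintro X Y ⟨f⟩
    exact (Quot.sound (PreHom.of_comp (𝟙 X.obj) f)).trans (by rw [Category.id_comp])
  comp_id := by
    rintro X Y ⟨f⟩
    exact (Quot.sound (PreHom.comp_of f (𝟙 Y.obj))).trans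
      (by rw [MonoidalCategory.whiskerLeft_id, Category.comp_id])
  assoc := by
    rintro X Y Z W ⟨f⟩ ⟨g⟩ ⟨h⟩
    refine Quot.sound (PreHom.rel_of_hom (α_ f.obj g.obj h.obj).hom ?_)
    simp only [PreHom.comp, MonoidalCategory.whiskerLeft_comp, Category.assoc]
    rw [associator_inv_naturality_middle_assoc, ← comp_whiskerRight, ← comp_whiskerRight,
      ← whisker_exchange_assoc, associator_inv_naturality_left_assoc, ← comp_whiskerRight,
      Functor.LaxMonoidal.associativity]
    simp

variable (F G φ) in
/-- The functor from `C` to the relative cokernel that is the identity on objects. -/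
def proj : C ⥤ RelCoker F G φ where
  obj X := ⟨X⟩
  map f := Quot.mk _ (PreHom.of f)
  map_id _ := rfl
  map_comp f g := by
    refine ((Quot.sound (PreHom.of_comp f (PreHom.of g))).trans ?_).symm
    simp only [PreHom.of, Category.assoc]

@[simp] lemma proj_obj_obj (X : C) : ((proj F G φ).obj X).obj = X := rfl

variable (φ) in
/-- The morphism of the relative cokernel represented by `(b, f)`. -/
def cls {X Y : C} (f : PreHom G X Y) : (proj F G φ).obj X ⟶ (proj F G φ).obj Y := Quot.mk _ f

lemma cls_comp_cls {X Y Z : C} (f : PreHom G X Y) (g : PreHom G Y Z) :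
    cls φ f ≫ cls φ g = cls φ (f.comp g) := rfl

lemma exists_eq_cls {X Y : C} (f : (proj F G φ).obj X ⟶ (proj F G φ).obj Y) :
    ∃ g : PreHom G X Y, f = cls φ g := by
  obtain ⟨g⟩ := f
  exact ⟨g, rfl⟩

lemma cls_sound {X Y : C} {f g : PreHom G X Y} (h : PreHom.Rel φ f g) : cls φ f = cls φ g :=
  Quot.sound h

lemma proj_map_eq_cls {X Y : C} (f : X ⟶ Y) : (proj F G φ).map f = cls φ (PreHom.of f) := rfl

lemma proj_map_comp_cls {X Y Z : C} (f : X ⟶ Y) (g : PreHom G Y Z) :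
    (proj F G φ).map f ≫ cls φ g = cls φ { obj := g.obj, arr := f ≫ g.arr } :=
  Quot.sound (PreHom.of_comp f g)

lemma cls_comp_proj_map {X Y Z : C} (f : PreHom G X Y) (g : Y ⟶ Z) :
    cls φ f ≫ (proj F G φ).map g = cls φ { obj := f.obj, arr := f.arr ≫ G.obj f.obj ◁ g } :=
  Quot.sound (PreHom.comp_of f g)

variable (φ) in
/-- The class of `(b, id) : G b + Y ⟶ Y`. -/
def act (b : B) (Y : C) : (proj F G φ).obj (G.obj b ⊗ Y) ⟶ (proj F G φ).obj Y :=
  cls φ { obj := b, arr := 𝟙 (G.obj b ⊗ Y) }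

lemma cls_eq {X Y : C} (f : PreHom G X Y) :
    cls φ f = (proj F G φ).map f.arr ≫ act φ f.obj Y := by
  simp only [act, proj_map_comp_cls, Category.comp_id]

lemma act_naturality (b : B) {Y Y' : C} (f : Y ⟶ Y') :
    act φ b Y ≫ (proj F G φ).map f = (proj F G φ).map (G.obj b ◁ f) ≫ act φ b Y' := by
  simp only [act, proj_map_comp_cls, cls_comp_proj_map, Category.comp_id, Category.id_comp]

lemma act_tensor (b b' : B) (Y : C) :
    act φ b (G.obj b' ⊗ Y) ≫ act φ b' Y =
      (proj F G φ).map ((α_ _ _ _).inv ≫ μ G b b' ▷ Y) ≫ act φ (b ⊗ b') Y := by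
  simp only [act, proj_map_comp_cls, Category.comp_id, cls_comp_cls, PreHom.comp,
    Category.id_comp, MonoidalCategory.whiskerLeft_id]

lemma map_act_rel {b b' : B} (a : A) (t : b ⟶ F.obj a ⊗ b') (Y : C) :
    (proj F G φ).map ((G.map t ≫ collapse φ a b') ▷ Y) ≫ act φ b' Y = act φ b Y := by
  simp only [act, proj_map_comp_cls, Category.comp_id]
  exact (cls_sound ⟨a, t, by simp⟩).symm

lemma map_act {b b' : B} (t : b ⟶ b') (Y : C) :
    (proj F G φ).map (G.map t ▷ Y) ≫ act φ b' Y = act φ b Y := by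
  simp only [act, proj_map_comp_cls, Category.comp_id]
  exact (cls_sound (PreHom.rel_of_hom t (by simp))).symm

lemma act_unit (Y : C) :
    (proj F G φ).map ((λ_ Y).inv ≫ ε G ▷ Y) ≫ act φ (𝟙_ B) Y = 𝟙 _ := by
  rw [← (proj F G φ).map_id, proj_map_eq_cls (𝟙 Y)]
  simp only [act, proj_map_comp_cls, Category.comp_id, PreHom.of, Category.id_comp]

lemma act_swap (b b' : B) (Y : C) :
    act φ b (G.obj b' ⊗ Y) ≫ act φ b' Y =
      (proj F G φ).map (swapLeft _ _ _) ≫ act φ b' (G.obj b ⊗ Y) ≫ act φ b Y := by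
  rw [act_tensor, act_tensor, ← map_act (β_ b b').hom Y, ← Functor.map_comp_assoc,
    ← Functor.map_comp_assoc]
  congr 2
  simp [swapLeft, ← comp_whiskerRight]

end

section Monoidal

variable [BraidedCategory B] [BraidedCategory C]
  {F : A ⥤ B} [F.Monoidal] {G : B ⥤ C} [G.Braided] {φ : F ⋙ G ⟶ zeroFunctor A C}
  [NatTrans.IsMonoidal φ]

/-- The representative `(b, Z + X ⟶ Z + (G b + Y) ≅ G b + (Z + Y))` of `Z + [b, f]`. -/
def PreHom.whiskerLeft (Z : C) {X Y : C} (f : PreHom G X Y) : PreHom G (Z ⊗ X) (Z ⊗ Y) where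
  obj := f.obj
  arr := Z ◁ f.arr ≫ swapLeft _ _ _

/-- The representative `(b, X + Z ⟶ (G b + Y) + Z ≅ G b + (Y + Z))` of `[b, f] + Z`. -/
def PreHom.whiskerRight {X Y : C} (f : PreHom G X Y) (Z : C) : PreHom G (X ⊗ Z) (Y ⊗ Z) where
  obj := f.obj
  arr := f.arr ▷ Z ≫ (α_ _ _ _).hom

lemma PreHom.whiskerLeft_rel (Z : C) {X Y : C} {f g : PreHom G X Y} (h : PreHom.Rel φ f g) :
    PreHom.Rel φ (f.whiskerLeft Z) (g.whiskerLeft Z) := by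
  obtain ⟨a, t, ht⟩ := h
  refine ⟨a, t, ?_⟩
  simp only [PreHom.whiskerLeft, ← ht, MonoidalCategory.whiskerLeft_comp, Category.assoc]
  rw [swapLeft_natural_mid]

lemma PreHom.whiskerRight_rel {X Y : C} {f g : PreHom G X Y} (h : PreHom.Rel φ f g) (Z : C) :
    PreHom.Rel φ (f.whiskerRight Z) (g.whiskerRight Z) := by
  obtain ⟨a, t, ht⟩ := h
  refine ⟨a, t, ?_⟩
  simp only [PreHom.whiskerRight, ← ht, comp_whiskerRight, Category.assoc]
  simp

/-- The sum `Z + f`. -/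
def wl (Z : C) {X Y : C} (f : (proj F G φ).obj X ⟶ (proj F G φ).obj Y) :
    (proj F G φ).obj (Z ⊗ X) ⟶ (proj F G φ).obj (Z ⊗ Y) :=
  Quot.map (PreHom.whiskerLeft Z) (fun _ _ h ↦ PreHom.whiskerLeft_rel Z h) f

/-- The sum `f + Z`. -/
def wr {X Y : C} (f : (proj F G φ).obj X ⟶ (proj F G φ).obj Y) (Z : C) :
    (proj F G φ).obj (X ⊗ Z) ⟶ (proj F G φ).obj (Y ⊗ Z) :=
  Quot.map (fun f ↦ PreHom.whiskerRight f Z) (fun _ _ h ↦ PreHom.whiskerRight_rel h Z) f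

lemma wl_cls (Z : C) {X Y : C} (f : PreHom G X Y) :
    wl Z (cls φ f) = cls φ (f.whiskerLeft Z) := rfl

lemma wr_cls {X Y : C} (f : PreHom G X Y) (Z : C) :
    wr (cls φ f) Z = cls φ (f.whiskerRight Z) := rfl

lemma wl_proj (Z : C) {X Y : C} (f : X ⟶ Y) :
    wl Z ((proj F G φ).map f) = (proj F G φ).map (Z ◁ f) := by
  simp only [proj_map_eq_cls, wl_cls, PreHom.of, PreHom.whiskerLeft,
    MonoidalCategory.whiskerLeft_comp, Category.assoc]
  rw [swapLeft_natural_mid, ← reassoc_of% @swapLeft_unit_mid_inv]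

lemma wr_proj {X Y : C} (f : X ⟶ Y) (Z : C) :
    wr ((proj F G φ).map f) Z = (proj F G φ).map (f ▷ Z) := by
  simp [proj_map_eq_cls, wr_cls, PreHom.of, PreHom.whiskerRight,
    -Functor.LaxMonoidal.left_unitality]

lemma wl_comp (Z : C) {X Y W : C} (f : (proj F G φ).obj X ⟶ (proj F G φ).obj Y)
    (g : (proj F G φ).obj Y ⟶ (proj F G φ).obj W) : wl Z (f ≫ g) = wl Z f ≫ wl Z g := by
  obtain ⟨f, rfl⟩ := exists_eq_cls f
  obtain ⟨g, rfl⟩ := exists_eq_cls g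
  rw [cls_comp_cls, wl_cls, wl_cls, wl_cls, cls_comp_cls]
  refine congrArg (cls φ) (congrArg (PreHom.mk (f.obj ⊗ g.obj)) ?_)
  simp only [PreHom.whiskerLeft, PreHom.comp, MonoidalCategory.whiskerLeft_comp, Category.assoc]
  rw [swapLeft_natural_mid, reassoc_of% @swapLeft_tensor_mid, reassoc_of% @swapLeft_natural_right]

lemma wr_comp {X Y W : C} (f : (proj F G φ).obj X ⟶ (proj F G φ).obj Y)
    (g : (proj F G φ).obj Y ⟶ (proj F G φ).obj W) (Z : C) : wr (f ≫ g) Z = wr f Z ≫ wr g Z := by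
  obtain ⟨f, rfl⟩ := exists_eq_cls f
  obtain ⟨g, rfl⟩ := exists_eq_cls g
  rw [cls_comp_cls, wr_cls, wr_cls, wr_cls, cls_comp_cls]
  refine congrArg (cls φ) (congrArg (PreHom.mk (f.obj ⊗ g.obj)) ?_)
  simp [PreHom.whiskerRight, PreHom.comp]

lemma wl_act (Z : C) (b : B) (Y : C) :
    wl Z (act φ b Y) = (proj F G φ).map (swapLeft _ _ _) ≫ act φ b (Z ⊗ Y) := by
  simp only [act, wl_cls, proj_map_comp_cls, PreHom.whiskerLeft, MonoidalCategory.whiskerLeft_id,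
    Category.id_comp, Category.comp_id]

lemma wr_act (b : B) (Y Z : C) :
    wr (act φ b Y) Z = (proj F G φ).map (α_ _ _ _).hom ≫ act φ b (Y ⊗ Z) := by
  simp only [act, wr_cls, proj_map_comp_cls, PreHom.whiskerRight, id_whiskerRight,
    Category.id_comp, Category.comp_id]

/-- To prove a property of morphisms of the relative cokernel that is stable under composition, it
suffices to prove it for morphisms of `C` and for the morphisms `G b + Y ⟶ Y`. -/
lemma hom_induction {P : ∀ {X Y : C}, ((proj F G φ).obj X ⟶ (proj F G φ).obj Y) → Prop}
    (hproj : ∀ {X Y : C} (f : X ⟶ Y), P ((proj F G φ).map f))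
    (hact : ∀ (b : B) (Y : C), P (act φ b Y))
    (hcomp : ∀ {X Y Z : C} (f : (proj F G φ).obj X ⟶ (proj F G φ).obj Y)
      (g : (proj F G φ).obj Y ⟶ (proj F G φ).obj Z), P f → P g → P (f ≫ g))
    {X Y : C} (f : (proj F G φ).obj X ⟶ (proj F G φ).obj Y) : P f := by
  obtain ⟨f, rfl⟩ := exists_eq_cls f
  have := hcomp _ _ (hproj f.arr) (hact f.obj Y)
  rwa [← cls_eq] at this

lemma wr_wl_exchange {X Y X' Y' : C} (f : (proj F G φ).obj X ⟶ (proj F G φ).obj Y)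
    (g : (proj F G φ).obj X' ⟶ (proj F G φ).obj Y') :
    wr f X' ≫ wl Y g = wl X g ≫ wr f Y' := by
  induction f using hom_induction generalizing X' Y' with
  | hcomp f f' hf hf' => rw [wr_comp, wr_comp, Category.assoc, hf', ← Category.assoc, hf,
      Category.assoc]
  | hproj f =>
    induction g using hom_induction with
    | hcomp g g' hg hg' => rw [wl_comp, wl_comp, Category.assoc, ← hg', ← Category.assoc, hg,
        Category.assoc]
    | hproj g => rw [wr_proj, wr_proj, wl_proj, wl_proj, ← Functor.map_comp, ← Functor.map_comp,
        whisker_exchange]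
    | hact b' Y' =>
      rw [wr_proj, wr_proj, wl_act, wl_act, Category.assoc, act_naturality,
        ← Functor.map_comp_assoc, ← Functor.map_comp_assoc, swapLeft_natural_left]
  | hact b Y =>
    induction g using hom_induction with
    | hcomp g g' hg hg' => rw [wl_comp, wl_comp, Category.assoc, ← hg', ← Category.assoc, hg,
        Category.assoc]
    | hproj g =>
      rw [wr_act, wr_act, wl_proj, wl_proj, Category.assoc, act_naturality,
        ← Functor.map_comp_assoc, ← Functor.map_comp_assoc]
      simp
    | hact b' Y' =>
      rw [wr_act, wr_act, wl_act, wl_act, Category.assoc, reassoc_of% @act_naturality, act_swap,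
        Category.assoc, reassoc_of% @act_naturality]
      simp only [← Functor.map_comp_assoc]
      rw [swapLeft_tensor_left]

lemma wr_wr_associator {X Y : C} (f : (proj F G φ).obj X ⟶ (proj F G φ).obj Y) (Z W : C) :
    wr (wr f Z) W ≫ (proj F G φ).map (α_ Y Z W).hom =
      (proj F G φ).map (α_ X Z W).hom ≫ wr f (Z ⊗ W) := by
  induction f using hom_induction with
  | hcomp f f' hf hf' =>
    rw [wr_comp, wr_comp, wr_comp, Category.assoc, hf', ← Category.assoc, hf, Category.assoc]
  | hproj f => simp [wr_proj, ← Functor.map_comp]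
  | hact b Y =>
    rw [wr_act, wr_act, wr_comp, wr_act, wr_proj]
    simp only [Category.assoc, act_naturality, ← Functor.map_comp_assoc, pentagon]

lemma wr_wl_associator (Z : C) {X Y : C} (f : (proj F G φ).obj X ⟶ (proj F G φ).obj Y) (W : C) :
    wr (wl Z f) W ≫ (proj F G φ).map (α_ Z Y W).hom =
      (proj F G φ).map (α_ Z X W).hom ≫ wl Z (wr f W) := by
  induction f using hom_induction with
  | hcomp f f' hf hf' =>
    rw [wl_comp, wr_comp, wr_comp, wl_comp, Category.assoc, hf', ← Category.assoc, hf,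
      Category.assoc]
  | hproj f => simp [wr_proj, wl_proj, ← Functor.map_comp]
  | hact b Y =>
    simp only [wr_act, wl_act, wr_comp, wl_comp, wr_proj, wl_proj, Category.assoc, act_naturality,
      ← Functor.map_comp_assoc, swapLeft_tensor_right]

lemma wl_wl_associator (Z W : C) {X Y : C} (f : (proj F G φ).obj X ⟶ (proj F G φ).obj Y) :
    wl (Z ⊗ W) f ≫ (proj F G φ).map (α_ Z W Y).hom =
      (proj F G φ).map (α_ Z W X).hom ≫ wl Z (wl W f) := by
  induction f using hom_induction with
  | hcomp f f' hf hf' =>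
    rw [wl_comp, wl_comp, wl_comp, Category.assoc, hf', ← Category.assoc, hf, Category.assoc]
  | hproj f => simp [wl_proj, ← Functor.map_comp]
  | hact b Y =>
    simp only [wl_act, wl_comp, wl_proj, Category.assoc, act_naturality,
      ← Functor.map_comp_assoc, swapLeft_tensor_left]

lemma wl_leftUnitor {X Y : C} (f : (proj F G φ).obj X ⟶ (proj F G φ).obj Y) :
    wl (𝟙_ C) f ≫ (proj F G φ).map (λ_ Y).hom = (proj F G φ).map (λ_ X).hom ≫ f := by
  induction f using hom_induction with
  | hcomp f f' hf hf' => rw [wl_comp, Category.assoc, hf', ← Category.assoc, hf, Category.assoc]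
  | hproj f => rw [wl_proj, ← Functor.map_comp, ← Functor.map_comp, leftUnitor_naturality]
  | hact b Y =>
    rw [wl_act, Category.assoc, act_naturality, ← Functor.map_comp_assoc, swapLeft_unit_left]

lemma wr_rightUnitor {X Y : C} (f : (proj F G φ).obj X ⟶ (proj F G φ).obj Y) :
    wr f (𝟙_ C) ≫ (proj F G φ).map (ρ_ Y).hom = (proj F G φ).map (ρ_ X).hom ≫ f := by
  induction f using hom_induction with
  | hcomp f f' hf hf' => rw [wr_comp, Category.assoc, hf', ← Category.assoc, hf, Category.assoc]
  | hproj f => rw [wr_proj, ← Functor.map_comp, ← Functor.map_comp, rightUnitor_naturality]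
  | hact b Y =>
    rw [wr_act, Category.assoc, act_naturality, ← Functor.map_comp_assoc, rightUnitor_tensor_hom]

/-- Sums of objects and the associativity, unit and symmetry isomorphisms are those of `C`. -/
instance : MonoidalCategoryStruct (RelCoker F G φ) where
  tensorObj X Y := ⟨X.obj ⊗ Y.obj⟩
  tensorUnit := ⟨𝟙_ C⟩
  whiskerLeft Z _ _ f := wl Z.obj f
  whiskerRight f Z := wr f Z.obj
  tensorHom {_ Y₁ X₂ _} f g := wr f X₂.obj ≫ wl Y₁.obj g
  associator X Y Z := (proj F G φ).mapIso (α_ X.obj Y.obj Z.obj)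
  leftUnitor X := (proj F G φ).mapIso (λ_ X.obj)
  rightUnitor X := (proj F G φ).mapIso (ρ_ X.obj)

lemma wl_id (X Y : C) : wl X (𝟙 ((proj F G φ).obj Y)) = 𝟙 _ := by
  rw [← (proj F G φ).map_id, wl_proj, MonoidalCategory.whiskerLeft_id, (proj F G φ).map_id]

lemma wr_id (X Y : C) : wr (𝟙 ((proj F G φ).obj X)) Y = 𝟙 _ := by
  rw [← (proj F G φ).map_id, wr_proj, id_whiskerRight, (proj F G φ).map_id]

lemma tensorHom_comp_aux {X₁ Y₁ Z₁ X₂ Y₂ Z₂ : C}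
    (f₁ : (proj F G φ).obj X₁ ⟶ (proj F G φ).obj Y₁) (f₂ : (proj F G φ).obj X₂ ⟶ (proj F G φ).obj Y₂)
    (g₁ : (proj F G φ).obj Y₁ ⟶ (proj F G φ).obj Z₁)
    (g₂ : (proj F G φ).obj Y₂ ⟶ (proj F G φ).obj Z₂) :
    (wr f₁ X₂ ≫ wl Y₁ f₂) ≫ (wr g₁ Y₂ ≫ wl Z₁ g₂) = wr (f₁ ≫ g₁) X₂ ≫ wl Z₁ (f₂ ≫ g₂) := by
  rw [wr_comp, wl_comp, Category.assoc, Category.assoc, ← Category.assoc (wl Y₁ f₂),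
    ← wr_wl_exchange, Category.assoc]

lemma associator_naturality_aux {X₁ X₂ X₃ Y₁ Y₂ Y₃ : C}
    (f₁ : (proj F G φ).obj X₁ ⟶ (proj F G φ).obj Y₁) (f₂ : (proj F G φ).obj X₂ ⟶ (proj F G φ).obj Y₂)
    (f₃ : (proj F G φ).obj X₃ ⟶ (proj F G φ).obj Y₃) :
    (wr (wr f₁ X₂ ≫ wl Y₁ f₂) X₃ ≫ wl (Y₁ ⊗ Y₂) f₃) ≫ (proj F G φ).map (α_ Y₁ Y₂ Y₃).hom =
      (proj F G φ).map (α_ X₁ X₂ X₃).hom ≫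
        (wr f₁ (X₂ ⊗ X₃) ≫ wl Y₁ (wr f₂ X₃ ≫ wl Y₂ f₃)) := by
  rw [Category.assoc, wl_wl_associator, wr_comp, Category.assoc, ← Category.assoc (wr (wl Y₁ f₂) X₃),
    wr_wl_associator, Category.assoc, ← Category.assoc (wr (wr f₁ X₂) X₃), wr_wr_associator,
    wl_comp, Category.assoc]

instance : MonoidalCategory (RelCoker F G φ) where
  tensorHom_def _ _ := rfl
  id_tensorHom_id X Y := by
    change wr (𝟙 ((proj F G φ).obj X.obj)) Y.obj ≫ wl X.obj (𝟙 ((proj F G φ).obj Y.obj)) = 𝟙 _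
    rw [wr_id, wl_id, Category.comp_id]
  tensorHom_comp_tensorHom f₁ f₂ g₁ g₂ := tensorHom_comp_aux f₁ f₂ g₁ g₂
  whiskerLeft_id X Y := wl_id X.obj Y.obj
  id_whiskerRight X Y := wr_id X.obj Y.obj
  associator_naturality f₁ f₂ f₃ := associator_naturality_aux f₁ f₂ f₃
  leftUnitor_naturality f := wl_leftUnitor f
  rightUnitor_naturality f := wr_rightUnitor f
  pentagon X Y Z W := by
    change wr ((proj F G φ).map _) _ ≫ (proj F G φ).map _ ≫ wl _ ((proj F G φ).map _) =
      (proj F G φ).map _ ≫ (proj F G φ).map _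
    rw [wr_proj, wl_proj, ← Functor.map_comp, ← Functor.map_comp, ← Functor.map_comp]
    exact congrArg _ (MonoidalCategory.pentagon X.obj Y.obj Z.obj W.obj)
  triangle X Y := by
    change (proj F G φ).map _ ≫ wl _ ((proj F G φ).map _) = wr ((proj F G φ).map _) _
    rw [wr_proj, wl_proj, ← Functor.map_comp]
    exact congrArg _ (MonoidalCategory.triangle X.obj Y.obj)

end Monoidal

section Symmetric

variable [BraidedCategory B] [SymmetricCategory C]
  {F : A ⥤ B} [F.Monoidal] {G : B ⥤ C} [G.Braided] {φ : F ⋙ G ⟶ zeroFunctor A C}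
  [NatTrans.IsMonoidal φ]

lemma wr_braiding {X Y : C} (f : (proj F G φ).obj X ⟶ (proj F G φ).obj Y) (Z : C) :
    wr f Z ≫ (proj F G φ).map (β_ Y Z).hom = (proj F G φ).map (β_ X Z).hom ≫ wl Z f := by
  induction f using hom_induction with
  | hcomp f f' hf hf' =>
    rw [wr_comp, wl_comp, Category.assoc, hf', ← Category.assoc, hf, Category.assoc]
  | hproj f => rw [wr_proj, wl_proj, ← Functor.map_comp, ← Functor.map_comp,
      BraidedCategory.braiding_naturality_left]
  | hact b Y =>
    rw [wr_act, wl_act, Category.assoc, act_naturality, ← Functor.map_comp_assoc,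
      ← Functor.map_comp_assoc]
    congr 2
    simp [swapLeft, SymmetricCategory.braiding_swap_eq_inv_braiding Z]

lemma wl_braiding (Z : C) {X Y : C} (f : (proj F G φ).obj X ⟶ (proj F G φ).obj Y) :
    wl Z f ≫ (proj F G φ).map (β_ Z Y).hom = (proj F G φ).map (β_ Z X).hom ≫ wr f Z := by
  rw [← cancel_mono ((proj F G φ).map (β_ Y Z).hom), Category.assoc, ← Functor.map_comp,
    SymmetricCategory.symmetry, Category.assoc, wr_braiding, ← Functor.map_comp_assoc,
    SymmetricCategory.symmetry]
  simp

instance : SymmetricCategory (RelCoker F G φ) where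
  braiding X Y := (proj F G φ).mapIso (β_ X.obj Y.obj)
  braiding_naturality_left f Z := wr_braiding f Z.obj
  braiding_naturality_right X _ _ f := wl_braiding X.obj f
  hexagon_forward X Y Z := by
    change (proj F G φ).map _ ≫ (proj F G φ).map _ ≫ (proj F G φ).map _ =
      wr ((proj F G φ).map _) _ ≫ (proj F G φ).map _ ≫ wl _ ((proj F G φ).map _)
    rw [wr_proj, wl_proj, ← Functor.map_comp, ← Functor.map_comp, ← Functor.map_comp,
      ← Functor.map_comp]
    exact congrArg _ (BraidedCategory.hexagon_forward X.obj Y.obj Z.obj)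
  hexagon_reverse X Y Z := by
    change (proj F G φ).map _ ≫ (proj F G φ).map _ ≫ (proj F G φ).map _ =
      wl _ ((proj F G φ).map _) ≫ (proj F G φ).map _ ≫ wr ((proj F G φ).map _) _
    rw [wr_proj, wl_proj, ← Functor.map_comp, ← Functor.map_comp, ← Functor.map_comp,
      ← Functor.map_comp]
    exact congrArg _ (BraidedCategory.hexagon_reverse X.obj Y.obj Z.obj)
  symmetry X Y := by
    change (proj F G φ).map _ ≫ (proj F G φ).map _ = 𝟙 _
    rw [← Functor.map_comp]
    exact (congrArg _ (SymmetricCategory.symmetry X.obj Y.obj)).trans ((proj F G φ).map_id _)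

end Symmetric

section TwoGroup

variable [BraidedCategory B] [BraidedCategory C] [IsTwoGroup B] [IsTwoGroup C]
  {F : A ⥤ B} [F.Monoidal] {G : B ⥤ C} [G.Braided] {φ : F ⋙ G ⟶ zeroFunctor A C}
  [NatTrans.IsMonoidal φ]

instance act_unit_isIso (Y : C) : IsIso (act φ (𝟙_ B) Y) := by
  have h := act_unit (φ := φ) Y
  have : IsIso ((proj F G φ).map ((λ_ Y).inv ≫ ε G ▷ Y) ≫ act φ (𝟙_ B) Y) := by
    rw [h]; infer_instance
  exact IsIso.of_isIso_comp_left ((proj F G φ).map ((λ_ Y).inv ≫ ε G ▷ Y)) _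

lemma act_comp_act_isIso {b b' : B} (e : b ⊗ b' ≅ 𝟙_ B) (Y : C) :
    IsIso (act φ b (G.obj b' ⊗ Y) ≫ act φ b' Y) := by
  rw [act_tensor, ← map_act e.hom Y]
  infer_instance

instance act_isIso (b : B) (Y : C) : IsIso (act φ b Y) := by
  have key : ∀ (b : B) (Y : C), IsSplitEpi (act φ b Y) := by
    intro b Y
    obtain ⟨b', ⟨e⟩⟩ := IsTwoGroup.exists_inverse b
    have := act_comp_act_isIso (φ := φ) ((β_ b' b) ≪≫ e) Y
    exact ⟨⟨inv (act φ b' (G.obj b ⊗ Y) ≫ act φ b Y) ≫ act φ b' (G.obj b ⊗ Y), by simp⟩⟩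
  obtain ⟨b', ⟨e⟩⟩ := IsTwoGroup.exists_inverse b
  have h := act_comp_act_isIso (φ := φ) ((β_ b' b) ≪≫ e) Y
  have := key b' (G.obj b ⊗ Y)
  have : Mono (act φ b' (G.obj b ⊗ Y)) := mono_of_mono _ (act φ b Y)
  have : IsIso (act φ b' (G.obj b ⊗ Y)) := isIso_of_mono_of_isSplitEpi _
  exact IsIso.of_isIso_comp_left (act φ b' (G.obj b ⊗ Y)) _

instance : IsTwoGroup (RelCoker F G φ) where
  all_isIso {X Y} f := by
    have h : ∀ {X Y : C} (f : (proj F G φ).obj X ⟶ (proj F G φ).obj Y), IsIso f := by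
      intro X Y f
      obtain ⟨f, rfl⟩ := exists_eq_cls f
      rw [cls_eq]
      infer_instance
    exact h (X := X.obj) (Y := Y.obj) f
  exists_inverse X := by
    obtain ⟨Y, ⟨e⟩⟩ := IsTwoGroup.exists_inverse X.obj
    exact ⟨⟨Y⟩, ⟨(proj F G φ).mapIso e⟩⟩

end TwoGroup

/-! #### Functors between relative cokernels -/

section Map

variable [BraidedCategory B] [BraidedCategory C]
  {F : A ⥤ B} [F.Monoidal] {G : B ⥤ C} [G.Braided] {φ : F ⋙ G ⟶ zeroFunctor A C}
  [NatTrans.IsMonoidal φ]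
variable {A' : Type*} [Category A'] [MonoidalCategory A']
variable {B' : Type*} [Category B'] [MonoidalCategory B'] [BraidedCategory B']
variable {C' : Type*} [Category C'] [MonoidalCategory C'] [BraidedCategory C']
variable {F' : A' ⥤ B'} [F'.Monoidal] {G' : B' ⥤ C'} [G'.Braided]
  {φ' : F' ⋙ G' ⟶ zeroFunctor A' C'} [NatTrans.IsMonoidal φ']
variable (P : A ⥤ A') (Q : B ⥤ B') [Q.Monoidal] (R : C ⥤ C') [R.Monoidal]
  (σ : F ⋙ Q ⟶ P ⋙ F') (ρ : G ⋙ R ⟶ Q ⋙ G') [NatTrans.IsMonoidal ρ]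
  (h : ∀ X : A, sqApp ρ (F.obj X) ≫ G'.map (sqApp σ X) ≫ nullApp φ' (P.obj X) =
    R.map (nullApp φ X) ≫ η R)

/-- The representative `(Q b, R X ⟶ R (G b + Y) ≅ R (G b) + R Y ≅ G' (Q b) + R Y)` of the image of
`[b, f]`. -/
def PreHom.map {X Y : C} (f : PreHom G X Y) : PreHom G' (R.obj X) (R.obj Y) where
  obj := Q.obj f.obj
  arr := R.map f.arr ≫ δ R _ _ ≫ sqApp ρ f.obj ▷ R.obj Y

lemma map_collapse (a : A) (b : B)
    (ha : sqApp ρ (F.obj a) ≫ G'.map (sqApp σ a) ≫ nullApp φ' (P.obj a) =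
      R.map (nullApp φ a) ≫ η R) :
    sqApp ρ (F.obj a ⊗ b) ≫ G'.map (δ Q _ _ ≫ sqApp σ a ▷ Q.obj b) ≫
      collapse φ' (P.obj a) (Q.obj b) = R.map (collapse φ a b) ≫ sqApp ρ b := by
  have h1 : (sqApp ρ (F.obj a) ⊗ₘ sqApp ρ b) ≫ G'.map (sqApp σ a) ▷ G'.obj (Q.obj b) ≫
      nullApp φ' (P.obj a) ▷ G'.obj (Q.obj b) =
        (R.map (nullApp φ a) ≫ η R) ▷ R.obj (G.obj b) ≫ 𝟙_ C' ◁ sqApp ρ b := by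
    rw [← ha, tensorHom_def', Category.assoc, ← comp_whiskerRight, ← comp_whiskerRight,
      whisker_exchange]
  simp only [collapse, Functor.map_comp, Category.assoc]
  rw [← δ_natural_left_assoc, reassoc_of% @sqApp_tensor_δ, reassoc_of% h1, leftUnitor_naturality,
    comp_whiskerRight_assoc, δ_natural_left_assoc, left_unitality_hom_assoc]

lemma PreHom.map_rel {X Y : C} {f g : PreHom G X Y}
    (h : ∀ X : A, sqApp ρ (F.obj X) ≫ G'.map (sqApp σ X) ≫ nullApp φ' (P.obj X) =
      R.map (nullApp φ X) ≫ η R) (hfg : PreHom.Rel φ f g) :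
    PreHom.Rel φ' (f.map Q R ρ) (g.map Q R ρ) := by
  obtain ⟨a, t, ht⟩ := hfg
  refine ⟨P.obj a, Q.map t ≫ δ Q _ _ ≫ sqApp σ a ▷ Q.obj _, ?_⟩
  simp only [PreHom.map, ← ht, Functor.map_comp, Category.assoc]
  rw [← δ_natural_left_assoc, ← comp_whiskerRight, ← comp_whiskerRight, Functor.map_comp,
    Category.assoc, ← map_collapse P Q R σ ρ a _ (h a), reassoc_of% @sqApp_naturality, Functor.map_comp]
  simp only [Category.assoc]

/-- The action on morphisms of the functor induced on relative cokernels. -/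
def mapHom {X Y : C} (f : (proj F G φ).obj X ⟶ (proj F G φ).obj Y) :
    (proj F' G' φ').obj (R.obj X) ⟶ (proj F' G' φ').obj (R.obj Y) :=
  Quot.map (PreHom.map Q R ρ) (fun _ _ hfg ↦ PreHom.map_rel P Q R σ ρ h hfg) f

lemma mapHom_cls {X Y : C} (f : PreHom G X Y) :
    mapHom P Q R σ ρ h (cls φ f) = cls φ' (f.map Q R ρ) := rfl

lemma mapHom_proj {X Y : C} (f : X ⟶ Y) :
    mapHom P Q R σ ρ h ((proj F G φ).map f) = (proj F' G' φ').map (R.map f) := by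
  rw [proj_map_eq_cls, proj_map_eq_cls, mapHom_cls]
  refine cls_sound (PreHom.rel_of_hom (η Q) ?_)
  simp only [PreHom.map, PreHom.of, Functor.map_comp, Category.assoc]
  have h1 : R.map (ε G) ≫ sqApp ρ (𝟙_ B) ≫ G'.map (η Q) = η R ≫ ε G' := by
    rw [← cancel_mono (η G'), Category.assoc, Category.assoc, sqApp_unit, Category.assoc, ε_η,
      map_ε_η_assoc, Category.comp_id]
  rw [← δ_natural_left_assoc, ← comp_whiskerRight, ← comp_whiskerRight, h1, comp_whiskerRight,
    Functor.OplaxMonoidal.left_unitality]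
  simp only [Category.assoc]

lemma mapHom_act (b : B) (Y : C) :
    mapHom P Q R σ ρ h (act φ b Y) =
      (proj F' G' φ').map (δ R _ _ ≫ sqApp ρ b ▷ R.obj Y) ≫ act φ' (Q.obj b) (R.obj Y) := by
  simp only [act, mapHom_cls, proj_map_comp_cls, PreHom.map, CategoryTheory.Functor.map_id,
    Category.id_comp, Category.comp_id]

lemma mapHom_comp {X Y Z : C} (f : (proj F G φ).obj X ⟶ (proj F G φ).obj Y)
    (g : (proj F G φ).obj Y ⟶ (proj F G φ).obj Z) :
    mapHom P Q R σ ρ h (f ≫ g) = mapHom P Q R σ ρ h f ≫ mapHom P Q R σ ρ h g := by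
  obtain ⟨f, rfl⟩ := exists_eq_cls f
  obtain ⟨g, rfl⟩ := exists_eq_cls g
  rw [cls_comp_cls, mapHom_cls, mapHom_cls, mapHom_cls, cls_comp_cls]
  refine cls_sound (PreHom.rel_of_hom (δ Q _ _) ?_)
  have h1 : R.map (μ G f.obj g.obj) ≫ sqApp ρ (f.obj ⊗ g.obj) ≫ G'.map (δ Q f.obj g.obj) =
      δ R _ _ ≫ (sqApp ρ f.obj ⊗ₘ sqApp ρ g.obj) ≫ μ G' _ _ := by
    rw [← cancel_mono (δ G' _ _)]
    simp only [Category.assoc]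
    rw [sqApp_tensor_δ, map_μ_δ_assoc, μ_δ, Category.comp_id]
  simp only [PreHom.map, PreHom.comp, Functor.map_comp, Category.assoc,
    MonoidalCategory.whiskerLeft_comp]
  rw [← δ_natural_left_assoc, ← comp_whiskerRight, ← comp_whiskerRight, h1,
    comp_whiskerRight, comp_whiskerRight, ← Functor.OplaxMonoidal.associativity_inv_assoc,
    ← δ_natural_right_assoc, tensorHom_def', comp_whiskerRight, Category.assoc,
    ← associator_inv_naturality_middle_assoc, ← associator_inv_naturality_left_assoc,
    ← whisker_exchange_assoc, ← whisker_exchange_assoc, ← whisker_exchange_assoc]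

/-- The functor induced on relative cokernels, given on objects by `X ↦ R X` and on morphisms by
`[b, f] ↦ [Q b, R X ⟶ R (G b + Y) ≅ R (G b) + R Y ≅ G' (Q b) + R Y]`. -/
def map : RelCoker F G φ ⥤ RelCoker F' G' φ' where
  obj X := ⟨R.obj X.obj⟩
  map f := mapHom P Q R σ ρ h f
  map_id X := by
    have h1 := mapHom_proj P Q R σ ρ h (𝟙 X.obj)
    rw [CategoryTheory.Functor.map_id, CategoryTheory.Functor.map_id,
      CategoryTheory.Functor.map_id] at h1
    exact h1
  map_comp f g := mapHom_comp P Q R σ ρ h f g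

@[simp] lemma map_obj_obj (X : RelCoker F G φ) :
    ((map P Q R σ ρ h).obj X).obj = R.obj X.obj := rfl

lemma map_map {X Y : C} (f : (proj F G φ).obj X ⟶ (proj F G φ).obj Y) :
    (map P Q R σ ρ h).map f = mapHom P Q R σ ρ h f := rfl

lemma mapHom_wr_aux {C C' : Type*} [Category C] [MonoidalCategory C] [Category C']
    [MonoidalCategory C'] (R : C ⥤ C') [R.Monoidal] {W : C'} {V : C} (Y Z : C) (r : R.obj V ⟶ W) :
    (δ R V Y ≫ r ▷ R.obj Y) ▷ R.obj Z ≫ (α_ W (R.obj Y) (R.obj Z)).hom ≫ W ◁ μ R Y Z =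
      μ R (V ⊗ Y) Z ≫ R.map (α_ V Y Z).hom ≫ δ R V (Y ⊗ Z) ≫ r ▷ R.obj (Y ⊗ Z) := by
  rw [← cancel_epi (μ R V Y ▷ R.obj Z), Functor.LaxMonoidal.associativity_assoc, μ_δ_assoc,
    ← comp_whiskerRight_assoc, μ_δ_assoc, associator_naturality_left_assoc, whisker_exchange]

lemma mapHom_wl_aux {C C' : Type*} [Category C] [MonoidalCategory C] [BraidedCategory C]
    [Category C'] [MonoidalCategory C'] [BraidedCategory C'] (R : C ⥤ C') [R.Braided] {W : C'}
    {V : C} (Y Z : C) (r : R.obj V ⟶ W) :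
    R.obj Z ◁ (δ R V Y ≫ r ▷ R.obj Y) ≫ swapLeft (R.obj Z) W (R.obj Y) ≫ W ◁ μ R Z Y =
      μ R Z (V ⊗ Y) ≫ R.map (swapLeft Z V Y) ≫ δ R V (Z ⊗ Y) ≫ r ▷ R.obj (Z ⊗ Y) := by
  rw [← cancel_epi (R.obj Z ◁ μ R V Y), reassoc_of% @map_swapLeft, μ_δ_assoc,
    ← whiskerLeft_comp_assoc, μ_δ_assoc, reassoc_of% @swapLeft_natural_mid, whisker_exchange]

lemma mapHom_wr {X Y : C} (f : (proj F G φ).obj X ⟶ (proj F G φ).obj Y) (Z : C) :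
    wr (mapHom P Q R σ ρ h f) (R.obj Z) ≫ (proj F' G' φ').map (μ R Y Z) =
      (proj F' G' φ').map (μ R X Z) ≫ mapHom P Q R σ ρ h (wr f Z) := by
  induction f using hom_induction with
  | hcomp f f' hf hf' =>
    rw [wr_comp, mapHom_comp, mapHom_comp, wr_comp, Category.assoc, hf', ← Category.assoc, hf,
      Category.assoc]
  | hproj f => rw [mapHom_proj, wr_proj, wr_proj, mapHom_proj, ← Functor.map_comp,
      ← Functor.map_comp, μ_natural_left]
  | hact b Y =>
    rw [wr_act, mapHom_comp, mapHom_proj, mapHom_act, mapHom_act, wr_comp, wr_act, wr_proj]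
    simp only [Category.assoc, act_naturality, ← Functor.map_comp_assoc]
    congr 2
    exact mapHom_wr_aux R _ _ _

lemma mapHom_wl {R : C ⥤ C'} [R.Braided] (ρ : G ⋙ R ⟶ Q ⋙ G') [NatTrans.IsMonoidal ρ]
    (h : ∀ X : A, sqApp ρ (F.obj X) ≫ G'.map (sqApp σ X) ≫ nullApp φ' (P.obj X) =
      R.map (nullApp φ X) ≫ η R)
    (Z : C) {X Y : C} (f : (proj F G φ).obj X ⟶ (proj F G φ).obj Y) :
    wl (R.obj Z) (mapHom P Q R σ ρ h f) ≫ (proj F' G' φ').map (μ R Z Y) =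
      (proj F' G' φ').map (μ R Z X) ≫ mapHom P Q R σ ρ h (wl Z f) := by
  induction f using hom_induction with
  | hcomp f f' hf hf' =>
    rw [wl_comp, mapHom_comp, mapHom_comp, wl_comp, Category.assoc, hf', ← Category.assoc, hf,
      Category.assoc]
  | hproj f => rw [mapHom_proj, wl_proj, wl_proj, mapHom_proj, ← Functor.map_comp,
      ← Functor.map_comp, μ_natural_right]
  | hact b Y =>
    rw [wl_act, mapHom_comp, mapHom_proj, mapHom_act, mapHom_act, wl_comp, wl_act, wl_proj]
    simp only [Category.assoc, act_naturality, ← Functor.map_comp_assoc]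
    congr 2
    exact mapHom_wl_aux R _ _ _

end Map

section BraidedFunctor

variable [BraidedCategory B] [SymmetricCategory C]
  {F : A ⥤ B} [F.Monoidal] {G : B ⥤ C} [G.Braided] {φ : F ⋙ G ⟶ zeroFunctor A C}
  [NatTrans.IsMonoidal φ]
variable {A' : Type*} [Category A'] [MonoidalCategory A']
variable {B' : Type*} [Category B'] [MonoidalCategory B'] [BraidedCategory B']
variable {C' : Type*} [Category C'] [MonoidalCategory C'] [SymmetricCategory C']
variable {F' : A' ⥤ B'} [F'.Monoidal] {G' : B' ⥤ C'} [G'.Braided]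
  {φ' : F' ⋙ G' ⟶ zeroFunctor A' C'} [NatTrans.IsMonoidal φ']
variable (P : A ⥤ A') (Q : B ⥤ B') [Q.Monoidal] (R : C ⥤ C') [R.Braided]
  (σ : F ⋙ Q ⟶ P ⋙ F') (ρ : G ⋙ R ⟶ Q ⋙ G') [NatTrans.IsMonoidal ρ]
  (h : ∀ X : A, sqApp ρ (F.obj X) ≫ G'.map (sqApp σ X) ≫ nullApp φ' (P.obj X) =
    R.map (nullApp φ X) ≫ η R)

/-- The monoidal structure of the induced functor is that of `R`. -/
instance : (map P Q R σ ρ h).Monoidal :=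
  Functor.CoreMonoidal.toMonoidal
    { εIso := (proj F' G' φ').mapIso (εIso R)
      μIso := fun X Y ↦ (proj F' G' φ').mapIso (μIso R X.obj Y.obj)
      μIso_hom_natural_left := fun f Z ↦ mapHom_wr P Q R σ ρ h f Z.obj
      μIso_hom_natural_right := fun Z f ↦ mapHom_wl P Q σ ρ h Z.obj f
      associativity := fun X Y Z ↦ by
        change wr ((proj F' G' φ').map (μ R X.obj Y.obj)) _ ≫ (proj F' G' φ').map _ ≫
            mapHom P Q R σ ρ h ((proj F G φ).map _) =
          (proj F' G' φ').map _ ≫ wl _ ((proj F' G' φ').map (μ R Y.obj Z.obj)) ≫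
            (proj F' G' φ').map _
        rw [wr_proj, wl_proj, mapHom_proj]
        have e := congrArg (proj F' G' φ').map (Functor.LaxMonoidal.associativity R X.obj Y.obj Z.obj)
        simp only [Functor.map_comp] at e
        exact e
      left_unitality := fun X ↦ by
        change (proj F' G' φ').map _ = wr ((proj F' G' φ').map (ε R)) _ ≫ (proj F' G' φ').map _ ≫
            mapHom P Q R σ ρ h ((proj F G φ).map _)
        rw [wr_proj, mapHom_proj]
        have e := congrArg (proj F' G' φ').map (Functor.LaxMonoidal.left_unitality R X.obj)
        simp only [Functor.map_comp] at e
        exact e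
      right_unitality := fun X ↦ by
        change (proj F' G' φ').map _ = wl _ ((proj F' G' φ').map (ε R)) ≫ (proj F' G' φ').map _ ≫
            mapHom P Q R σ ρ h ((proj F G φ).map _)
        rw [wl_proj, mapHom_proj]
        have e := congrArg (proj F' G' φ').map (Functor.LaxMonoidal.right_unitality R X.obj)
        simp only [Functor.map_comp] at e
        exact e }

instance : (map P Q R σ ρ h).Braided where
  braided X Y := by
    change (proj F' G' φ').map (μ R X.obj Y.obj) ≫ mapHom P Q R σ ρ h ((proj F G φ).map _) =
      (proj F' G' φ').map _ ≫ (proj F' G' φ').map _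
    rw [mapHom_proj]
    have e := congrArg (proj F' G' φ').map (Functor.LaxBraided.braided (F := R) X.obj Y.obj)
    rw [Functor.map_comp, Functor.map_comp] at e
    exact e

end BraidedFunctor

end RelCoker
end Cokernel

/-! ### 2-cells induced on relative kernels -/

namespace RelKer

section InducedCells

variable {A : Type*} [Category A] [MonoidalCategory A]
variable {B : Type*} [Category B] [MonoidalCategory B]
variable {C : Type*} [Category C] [MonoidalCategory C]
variable {Z : Type*} [Category Z] [MonoidalCategory Z]
variable {W : Type*} [Category W] [MonoidalCategory W]
variable {F : A ⥤ B} [F.Monoidal] {G : B ⥤ C} [G.Monoidal] (φ : F ⋙ G ⟶ zeroFunctor A C)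
  [NatTrans.IsMonoidal φ] (K : Z ⥤ A) (ψ : K ⋙ F ⟶ zeroFunctor Z B)
  (h : ∀ X : Z, G.map (nullApp ψ X) ≫ η G = nullApp φ (K.obj X))
  (E : W ⥤ Z) (χ : E ⋙ K ⟶ zeroFunctor W A)
  (h' : ∀ X : W, F.map (nullApp χ X) ≫ η F = nullApp ψ (E.obj X))

/-- The 2-cell `K' ∘ E ⟶ 0` with components `χ_X`, where `K'` is the factorization of `K` through
the relative kernel and `χ : K ∘ E ⟶ 0` is compatible with `ψ`. -/
def liftNull : E ⋙ lift φ K ψ h ⟶ zeroFunctor W (RelKer F G φ) where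
  app X := show (lift φ K ψ h).obj (E.obj X) ⟶ 𝟙_ (RelKer F G φ) from
    { hom := nullApp χ X
      w := h' X }
  naturality X Y f := by
    refine hom_ext ((nullApp_naturality χ f).trans ?_)
    exact (Category.comp_id (nullApp χ X)).symm

instance [K.Monoidal] [NatTrans.IsMonoidal ψ] [E.Monoidal] [NatTrans.IsMonoidal χ] :
    NatTrans.IsMonoidal (liftNull φ K ψ h E χ h') where
  unit := hom_ext (NatTrans.IsMonoidal.unit (τ := χ))
  tensor X Y := hom_ext (NatTrans.IsMonoidal.tensor (τ := χ) X Y)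

lemma nullApp_liftNull_hom (X : W) :
    (nullApp (liftNull φ K ψ h E χ h') X).hom = nullApp χ X := rfl

variable {A' : Type*} [Category A'] [MonoidalCategory A']
variable {B' : Type*} [Category B'] [MonoidalCategory B'] [IsGroupoid B']
variable {C' : Type*} [Category C'] [MonoidalCategory C'] [IsGroupoid C']
variable {Z' : Type*} [Category Z'] [MonoidalCategory Z']
variable {F' : A' ⥤ B'} [F'.Monoidal] {G' : B' ⥤ C'} [G'.Monoidal]
  (φ' : F' ⋙ G' ⟶ zeroFunctor A' C') [NatTrans.IsMonoidal φ']
  (K' : Z' ⥤ A') (ψ' : K' ⋙ F' ⟶ zeroFunctor Z' B')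
  (hψ' : ∀ X : Z', G'.map (nullApp ψ' X) ≫ η G' = nullApp φ' (K'.obj X))
  (S : Z ⥤ Z') (P : A ⥤ A') (Q : B ⥤ B') [Q.Monoidal] (R : C ⥤ C') [R.Monoidal]
  (τ : K ⋙ P ⟶ S ⋙ K') (σ : F ⋙ Q ⟶ P ⋙ F') (ρ : G ⋙ R ⟶ Q ⋙ G') [NatTrans.IsMonoidal ρ]
  (hρ : ∀ X : A, sqApp ρ (F.obj X) ≫ G'.map (sqApp σ X) ≫ nullApp φ' (P.obj X) =
    R.map (nullApp φ X) ≫ η R)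
  (hσ : ∀ X : Z, sqApp σ (K.obj X) ≫ F'.map (sqApp τ X) ≫ nullApp ψ' (S.obj X) =
    Q.map (nullApp ψ X) ≫ η Q)

/-- The 2-cell with components `τ_X` filling the square formed by two factorizations through
relative kernels and the functor induced on relative kernels. -/
def liftSq : lift φ K ψ h ⋙ map P Q R σ ρ hρ ⟶ S ⋙ lift φ' K' ψ' hψ' where
  app X := show (map P Q R σ ρ hρ).obj ((lift φ K ψ h).obj X) ⟶
      (lift φ' K' ψ' hψ').obj (S.obj X) from
    { hom := sqApp τ X
      w := by
        change F'.map (sqApp τ X) ≫ nullApp ψ' (S.obj X) =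
          inv (sqApp σ (K.obj X)) ≫ Q.map (nullApp ψ X) ≫ η Q
        rw [← hσ X, IsIso.inv_hom_id_assoc] }
  naturality X Y f := hom_ext (sqApp_naturality τ f)

variable [K.Monoidal] [NatTrans.IsMonoidal ψ] [K'.Monoidal] [NatTrans.IsMonoidal ψ'] [S.Monoidal]
  [P.Monoidal] [NatTrans.IsMonoidal σ] [NatTrans.IsMonoidal τ]

instance : NatTrans.IsMonoidal (liftSq φ K ψ h φ' K' ψ' hψ' S P Q R τ σ ρ hρ hσ) where
  unit := hom_ext (NatTrans.IsMonoidal.unit (τ := τ))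
  tensor X Y := hom_ext (NatTrans.IsMonoidal.tensor (τ := τ) X Y)

end InducedCells

end RelKer

/-! ### The 2-category of symmetric 2-groups -/

universe v u

set_option linter.checkUnivs false

/-- A symmetric 2-group (symmetric categorical group): a symmetric monoidal category in which every
morphism is invertible and every object is invertible up to isomorphism. -/
structure SymTwoGroup where
  carrier : Type u
  [category : Category.{v} carrier]
  [monoidal : MonoidalCategory carrier]
  [symmetric : SymmetricCategory carrier]
  [isTwoGroup : IsTwoGroup carrier]

namespace SymTwoGroup

instance : CoeSort SymTwoGroup.{v, u} (Type u) := ⟨carrier⟩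

attribute [instance] category monoidal symmetric isTwoGroup

/-- A 1-morphism of symmetric 2-groups: a (strong) symmetric monoidal functor. -/
structure Hom (A B : SymTwoGroup.{v, u}) where
  functor : A ⥤ B
  [braided : functor.Braided]

attribute [instance] Hom.braided

/-- A 2-morphism between 1-morphisms of symmetric 2-groups: a monoidal natural transformation. -/
@[ext]
structure Hom₂ {A B : SymTwoGroup.{v, u}} (F G : Hom A B) where
  natTrans : F.functor ⟶ G.functor
  [isMonoidal : NatTrans.IsMonoidal natTrans]

attribute [instance] Hom₂.isMonoidal

/-- The category of 1-morphisms `A ⟶ B` and 2-morphisms between them. -/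
instance (A B : SymTwoGroup.{v, u}) : Category (Hom A B) where
  Hom F G := Hom₂ F G
  id F := { natTrans := 𝟙 F.functor }
  comp f g := { natTrans := f.natTrans ≫ g.natTrans }
  id_comp f := Hom₂.ext (Category.id_comp f.natTrans)
  comp_id f := Hom₂.ext (Category.comp_id f.natTrans)
  assoc f g h := Hom₂.ext (Category.assoc f.natTrans g.natTrans h.natTrans)

end SymTwoGroup

/-! ### 2-chain complexes, their morphisms and homotopies -/

/-- A 2-chain complex of symmetric 2-groups
`… ⟶ A (n+2) ⟶ A (n+1) ⟶ A n ⟶ …`, with 1-morphisms `d n : A (n+1) ⟶ A n` and 2-morphisms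
`α n : d n ∘ d (n+1) ⟶ 0` such that the two resulting 2-morphisms `d n ∘ d (n+1) ∘ d (n+2) ⟶ 0`
coincide. -/
structure TwoChainComplex where
  obj : ℤ → SymTwoGroup.{v, u}
  d : ∀ n : ℤ, SymTwoGroup.Hom (obj (n + 1)) (obj n)
  α : ∀ n : ℤ, (d (n + 1)).functor ⋙ (d n).functor ⟶ zeroFunctor (obj (n + 1 + 1)) (obj n)
  [α_isMonoidal : ∀ n : ℤ, NatTrans.IsMonoidal (α n)]
  α_compat : ∀ (n : ℤ) (X : obj (n + 1 + 1 + 1)),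
    (d n).functor.map (nullApp (α (n + 1)) X) ≫ η (d n).functor =
      nullApp (α n) ((d (n + 1 + 1)).functor.obj X)

namespace TwoChainComplex

attribute [instance] α_isMonoidal

/-- A morphism of 2-chain complexes: 1-morphisms `F n : A n ⟶ B n` and 2-morphisms
`cell n : F n ∘ d n ⟶ d n ∘ F (n+1)` that are compatible with the 2-morphisms `α n` of `A`
and `B`. -/
structure Hom (A B : TwoChainComplex.{v, u}) where
  hom : ∀ n : ℤ, SymTwoGroup.Hom (A.obj n) (B.obj n)
  cell : ∀ n : ℤ,
    (A.d n).functor ⋙ (hom n).functor ⟶ (hom (n + 1)).functor ⋙ (B.d n).functor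
  [cell_isMonoidal : ∀ n : ℤ, NatTrans.IsMonoidal (cell n)]
  cell_compat : ∀ (n : ℤ) (X : A.obj (n + 1 + 1)),
    sqApp (cell n) ((A.d (n + 1)).functor.obj X) ≫ (B.d n).functor.map (sqApp (cell (n + 1)) X) ≫
        nullApp (B.α n) ((hom (n + 1 + 1)).functor.obj X) =
      (hom n).functor.map (nullApp (A.α n) X) ≫ η (hom n).functor

attribute [instance] Hom.cell_isMonoidal

variable {A B : TwoChainComplex.{v, u}}

/-- The 1-morphism `d ∘ H (n+1) + H n ∘ d + G (n+1) : A (n+1) ⟶ B (n+1)`, where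
`H n : A n ⟶ B (n+1)`. The sum of 1-morphisms is computed pointwise, and triple sums are bracketed
to the right. -/
abbrev homotopySum (H : ∀ n : ℤ, SymTwoGroup.Hom (A.obj n) (B.obj (n + 1))) (G : Hom A B)
    (n : ℤ) : A.obj (n + 1) ⥤ B.obj (n + 1) :=
  sumFunctor ((H (n + 1)).functor ⋙ (B.d (n + 1)).functor)
    (sumFunctor ((A.d n).functor ⋙ (H n).functor) (G.hom (n + 1)).functor)

section

variable {F G : Hom A B} {H : ∀ n : ℤ, SymTwoGroup.Hom (A.obj n) (B.obj (n + 1))}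
  (τ : ∀ n : ℤ, (F.hom (n + 1)).functor ⟶ homotopySum H G n)

/-- The component `F X ⟶ d (H X) + (H (d X) + G X)` of `τ n` at `X` in `A (n+1)`. -/
def homotopyApp (n : ℤ) (X : A.obj (n + 1)) :
    (F.hom (n + 1)).functor.obj X ⟶
      (B.d (n + 1)).functor.obj ((H (n + 1)).functor.obj X) ⊗
        ((H n).functor.obj ((A.d n).functor.obj X) ⊗ (G.hom (n + 1)).functor.obj X) :=
  (τ n).app X

/-- The morphism `F (d X) ⟶ d (F X) ⟶ d (d (H X) + (H (d X) + G X)) ≅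
d (d (H X)) + (d (H (d X)) + d (G X)) ⟶ 0 + (d (H (d X)) + d (G X)) ≅ d (H (d X)) + d (G X)`
obtained from the 2-cells of `F`, from `τ (n+1)` and from `d ∘ d ⟶ 0` in `B`. -/
def homotopyLeft (n : ℤ) (X : A.obj (n + 1 + 1)) :
    (F.hom (n + 1)).functor.obj ((A.d (n + 1)).functor.obj X) ⟶
      (B.d (n + 1)).functor.obj ((H (n + 1)).functor.obj ((A.d (n + 1)).functor.obj X)) ⊗
        (B.d (n + 1)).functor.obj ((G.hom (n + 1 + 1)).functor.obj X) :=
  sqApp (F.cell (n + 1)) X ≫ (B.d (n + 1)).functor.map (homotopyApp τ (n + 1) X) ≫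
    δ (B.d (n + 1)).functor _ _ ≫
      (nullApp (B.α (n + 1)) ((H (n + 1 + 1)).functor.obj X) ⊗ₘ δ (B.d (n + 1)).functor _ _) ≫
        (λ_ _).hom

/-- The morphism `F (d X) ⟶ d (H (d X)) + (H (d (d X)) + G (d X)) ⟶ d (H (d X)) + (0 + d (G X)) ≅
d (H (d X)) + d (G X)` obtained from `τ n`, from `d ∘ d ⟶ 0` in `A` and from the 2-cells of `G`. -/
def homotopyRight (n : ℤ) (X : A.obj (n + 1 + 1)) :
    (F.hom (n + 1)).functor.obj ((A.d (n + 1)).functor.obj X) ⟶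
      (B.d (n + 1)).functor.obj ((H (n + 1)).functor.obj ((A.d (n + 1)).functor.obj X)) ⊗
        (B.d (n + 1)).functor.obj ((G.hom (n + 1 + 1)).functor.obj X) :=
  homotopyApp τ n ((A.d (n + 1)).functor.obj X) ≫
    (_ ◁ ((((H n).functor.map (nullApp (A.α n) X) ≫ η (H n).functor) ⊗ₘ
      sqApp (G.cell (n + 1)) X) ≫ (λ_ _).hom))

end

/-- A 2-chain homotopy from `F` to `G`: 1-morphisms `H n : A n ⟶ B (n+1)` and 2-morphisms
`τ n : F (n+1) ⟶ d ∘ H (n+1) + H n ∘ d + G (n+1)` that are compatible with the differentials. -/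
structure Homotopy (F G : Hom A B) where
  H : ∀ n : ℤ, SymTwoGroup.Hom (A.obj n) (B.obj (n + 1))
  τ : ∀ n : ℤ, (F.hom (n + 1)).functor ⟶ homotopySum H G n
  [τ_isMonoidal : ∀ n : ℤ, NatTrans.IsMonoidal (τ n)]
  τ_compat : ∀ (n : ℤ) (X : A.obj (n + 1 + 1)), homotopyLeft τ n X = homotopyRight τ n X

attribute [instance] Homotopy.τ_isMonoidal

/-! ### Homology -/

section Homology

variable (A) (F : Hom A B) (k : ℤ)

/-- The relative kernel of `A (k+2) ⟶ A (k+1) ⟶ A k`. -/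
abbrev Cycles : Type (max u v) :=
  RelKer (A.d (k + 1)).functor (A.d k).functor (A.α k)

/-- The factorization `A (k+3) ⟶ Cycles` of `d (k+2)` through the relative kernel. -/
abbrev toCycles : A.obj (k + 1 + 1 + 1) ⥤ A.Cycles k :=
  RelKer.lift (A.α k) (A.d (k + 1 + 1)).functor (A.α (k + 1)) (A.α_compat k)

/-- The 2-morphism `toCycles ∘ d (k+3) ⟶ 0` with components those of `α (k+2)`. -/
abbrev toCyclesNull : (A.d (k + 1 + 1 + 1)).functor ⋙ A.toCycles k ⟶
    zeroFunctor (A.obj (k + 1 + 1 + 1 + 1)) (A.Cycles k) :=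
  RelKer.liftNull (A.α k) (A.d (k + 1 + 1)).functor (A.α (k + 1)) (A.α_compat k)
    (A.d (k + 1 + 1 + 1)).functor (A.α (k + 1 + 1)) (A.α_compat (k + 1))

/-- The homology symmetric 2-group at `A (k+2)`: the relative cokernel of
`A (k+4) ⟶ A (k+3) ⟶ Cycles`. -/
def homologyAux : SymTwoGroup.{max u v, max u v} where
  carrier := RelCoker (A.d (k + 1 + 1 + 1)).functor (A.toCycles k) (A.toCyclesNull k)

/-- The `n`-th homology symmetric 2-group of a 2-chain complex, located at `A n`
(note that `homologyAux k` is located at `A (k+2)`). -/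
def homology (n : ℤ) : SymTwoGroup.{max u v, max u v} := A.homologyAux (n - 2)

variable {A}

/-- The functor induced on relative kernels by a morphism of 2-chain complexes. -/
noncomputable abbrev cyclesMap : A.Cycles k ⥤ B.Cycles k :=
  RelKer.map (F.hom (k + 1 + 1)).functor (F.hom (k + 1)).functor (F.hom k).functor
    (F.cell (k + 1)) (F.cell k) (F.cell_compat k)

/-- The 2-morphism `cyclesMap ∘ toCycles ⟶ toCycles ∘ F (k+3)` with components those of
`F.cell (k+2)`. -/
noncomputable abbrev cyclesCell : A.toCycles k ⋙ cyclesMap F k ⟶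
    (F.hom (k + 1 + 1 + 1)).functor ⋙ B.toCycles k :=
  RelKer.liftSq (A.α k) (A.d (k + 1 + 1)).functor (A.α (k + 1)) (A.α_compat k)
    (B.α k) (B.d (k + 1 + 1)).functor (B.α (k + 1)) (B.α_compat k)
    (F.hom (k + 1 + 1 + 1)).functor (F.hom (k + 1 + 1)).functor (F.hom (k + 1)).functor
    (F.hom k).functor (F.cell (k + 1 + 1)) (F.cell (k + 1)) (F.cell k) (F.cell_compat k)
    (F.cell_compat (k + 1))

lemma cyclesCell_compat (X : A.obj (k + 1 + 1 + 1 + 1)) :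
    sqApp (cyclesCell F k) ((A.d (k + 1 + 1 + 1)).functor.obj X) ≫
        (B.toCycles k).map (sqApp (F.cell (k + 1 + 1 + 1)) X) ≫
          nullApp (B.toCyclesNull k) ((F.hom (k + 1 + 1 + 1 + 1)).functor.obj X) =
      (cyclesMap F k).map (nullApp (A.toCyclesNull k) X) ≫ η (cyclesMap F k) :=
  RelKer.hom_ext (F.cell_compat (k + 1 + 1) X)

/-- The functor induced on the relative cokernels that define homology. -/
noncomputable abbrev homologyFunctor :
    RelCoker (A.d (k + 1 + 1 + 1)).functor (A.toCycles k) (A.toCyclesNull k) ⥤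
      RelCoker (B.d (k + 1 + 1 + 1)).functor (B.toCycles k) (B.toCyclesNull k) :=
  RelCoker.map (F.hom (k + 1 + 1 + 1 + 1)).functor (F.hom (k + 1 + 1 + 1)).functor
    (cyclesMap F k) (F.cell (k + 1 + 1 + 1)) (cyclesCell F k) (cyclesCell_compat F k)

/-- The 1-morphism induced on the homology symmetric 2-groups at `A (k+2)` and `B (k+2)`. -/
noncomputable def homologyMapAux : SymTwoGroup.Hom (A.homologyAux k) (B.homologyAux k) :=
  SymTwoGroup.Hom.mk (A := A.homologyAux k) (B := B.homologyAux k) (homologyFunctor F k)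
    (braided := (inferInstance : (homologyFunctor F k).Braided))

/-- The 1-morphism induced by a morphism of 2-chain complexes on the `n`-th homology symmetric
2-groups. -/
noncomputable def homologyMap (n : ℤ) : SymTwoGroup.Hom (A.homology n) (B.homology n) :=
  homologyMapAux F (n - 2)

end Homology

end TwoChainComplex

/-!
A 2-chain homotopy `(H, τ)` from `F` to `G` gives, on a cycle `(X, a : d X ⟶ 0)`, the morphism
`F X ⟶ d (H X) + (H (d X) + G X) ⟶ d (H X) + G X` in which `H (d X)` is discarded by means of
`H a : H (d X) ⟶ H 0 ≅ 0`. Since `d (H X)` is a boundary, this represents a morphism `F X ⟶ G X` of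
the relative cokernel that defines homology, and these morphisms are the components of the required
2-cell.

The axiom of a homotopy enters twice. At the object `X` of a cycle, it shows that the morphism above
respects the second components of cycles (`Homotopy.map_cycleApp`). At an object `b` one degree
higher, it gives the naturality with respect to the generating morphisms `d b + Y ⟶ Y` of the
relative cokernel: the component of `τ` at `b` is the morphism `t` that identifies the two
representatives to be compared (`Homotopy.cycleTrans_compat`, `RelCoker.wr_sumCls_act`). All other
compatibilities follow from `τ` being a monoidal natural transformation. Finally, every 2-cell
between symmetric 2-groups is invertible.

The passage to the relative cokernel is done abstractly: `RelCoker.sumTrans` turns a 2-cell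
`θ : R ⟶ G' ∘ K + S` and a family of morphisms `t` as above into a 2-cell between the functors that
are induced on relative cokernels.
-/

/-! ### 2-cells between functors induced on relative cokernels -/

namespace RelCoker

section

variable {A : Type*} [Category A] [MonoidalCategory A]
variable {B : Type*} [Category B] [MonoidalCategory B] [BraidedCategory B]
variable {C : Type*} [Category C] [MonoidalCategory C] [BraidedCategory C]
variable {F : A ⥤ B} [F.Monoidal] {G : B ⥤ C} [G.Braided] {φ : F ⋙ G ⟶ zeroFunctor A C}
  [NatTrans.IsMonoidal φ]

/-- The morphisms `act φ b Y : G b + Y ⟶ Y` are natural in `Y` as an object of the relative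
cokernel, not only as an object of `C`. -/
lemma act_comp (b : B) {Y Y' : C} (f : (proj F G φ).obj Y ⟶ (proj F G φ).obj Y') :
    act φ b Y ≫ f = wl (G.obj b) f ≫ act φ b Y' := by
  induction f using hom_induction with
  | hproj f => rw [wl_proj, act_naturality]
  | hact b' Y => rw [wl_act, act_swap, Category.assoc]
  | hcomp f f' hf hf' => rw [wl_comp, Category.assoc, ← hf', ← Category.assoc, hf, Category.assoc]

end

section

variable {A : Type*} [Category A] [MonoidalCategory A]
variable {B : Type*} [Category B] [MonoidalCategory B] [BraidedCategory B]
variable {C : Type*} [Category C] [MonoidalCategory C] [SymmetricCategory C]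
variable {A' : Type*} [Category A'] [MonoidalCategory A']
variable {B' : Type*} [Category B'] [MonoidalCategory B'] [BraidedCategory B']
variable {C' : Type*} [Category C'] [MonoidalCategory C'] [SymmetricCategory C']
variable {F : A ⥤ B} [F.Monoidal] {G : B ⥤ C} [G.Braided] {φ : F ⋙ G ⟶ zeroFunctor A C}
  [NatTrans.IsMonoidal φ]
variable {F' : A' ⥤ B'} [F'.Monoidal] {G' : B' ⥤ C'} [G'.Braided]
  {φ' : F' ⋙ G' ⟶ zeroFunctor A' C'} [NatTrans.IsMonoidal φ']

section

variable {K : C ⥤ B'} {R S : C ⥤ C'} (θ : R ⟶ sumFunctor (K ⋙ G') S)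

/-- The component `R X ⟶ G' (K X) + S X` of a 2-cell `R ⟶ G' ∘ K + S`. -/
def sumApp (X : C) : R.obj X ⟶ G'.obj (K.obj X) ⊗ S.obj X := θ.app X

lemma sumApp_naturality {X Y : C} (f : X ⟶ Y) :
    R.map f ≫ sumApp θ Y = sumApp θ X ≫ (G'.map (K.map f) ⊗ₘ S.map f) :=
  θ.naturality f

lemma ε_sumApp [K.Monoidal] [R.Monoidal] [S.Monoidal] [NatTrans.IsMonoidal θ] :
    ε R ≫ sumApp θ (𝟙_ C) = (λ_ (𝟙_ C')).inv ≫ (ε G' ≫ G'.map (ε K) ⊗ₘ ε S) :=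
  NatTrans.IsMonoidal.unit (τ := θ)

lemma μ_sumApp [K.Monoidal] [R.Monoidal] [S.Monoidal] [NatTrans.IsMonoidal θ] (X Y : C) :
    μ R X Y ≫ sumApp θ (X ⊗ Y) =
      (sumApp θ X ⊗ₘ sumApp θ Y) ≫ tensorμ _ _ _ _ ≫
        (μ G' _ _ ≫ G'.map (μ K X Y) ⊗ₘ μ S X Y) :=
  NatTrans.IsMonoidal.tensor (τ := θ) X Y

/-- The morphism `R X ⟶ S X` of the relative cokernel that is represented by
`(K X, R X ⟶ G' (K X) + S X)`. -/
def sumCls (X : C) : (proj F' G' φ').obj (R.obj X) ⟶ (proj F' G' φ').obj (S.obj X) :=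
  cls φ' { obj := K.obj X, arr := sumApp θ X }

lemma sumCls_eq (X : C) :
    sumCls (φ' := φ') θ X = (proj F' G' φ').map (sumApp θ X) ≫ act φ' (K.obj X) (S.obj X) :=
  cls_eq _

lemma proj_map_sumCls {X Y : C} (f : X ⟶ Y) :
    (proj F' G' φ').map (R.map f) ≫ sumCls θ Y =
      sumCls (φ' := φ') θ X ≫ (proj F' G' φ').map (S.map f) := by
  rw [sumCls_eq, sumCls_eq, Category.assoc, act_naturality, ← Functor.map_comp_assoc,
    sumApp_naturality, ← map_act (K.map f), ← Functor.map_comp_assoc, ← Functor.map_comp_assoc,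
    Category.assoc, tensorHom_def']

variable [K.Monoidal] [R.Monoidal] [S.Monoidal] [NatTrans.IsMonoidal θ]

lemma sumCls_unit :
    (proj F' G' φ').map (ε R) ≫ sumCls θ (𝟙_ C) = (proj F' G' φ').map (ε S) := by
  rw [← Category.comp_id ((proj F' G' φ').map (ε S)), sumCls_eq, ← act_unit, ← map_act (ε K),
    ← Functor.map_comp_assoc, ← Functor.map_comp_assoc, ε_sumApp, ← Functor.map_comp_assoc]
  congr 2
  rw [tensorHom_def', comp_whiskerRight]
  simp

lemma sumCls_tensor (X Y : C) :
    (proj F' G' φ').map (μ R X Y) ≫ sumCls θ (X ⊗ Y) =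
      (wr (sumCls θ X) (R.obj Y) ≫ wl (S.obj X) (sumCls θ Y)) ≫
        (proj F' G' φ').map (μ S X Y) := by
  simp only [sumCls_eq, wr_comp, wl_comp, wr_proj, wl_proj, wr_act, wl_act, Category.assoc,
    act_naturality, reassoc_of% @act_naturality, act_tensor, ← Functor.map_comp_assoc, μ_sumApp]
  rw [← map_act (μ K X Y), ← Functor.map_comp_assoc]
  congr 2
  -- `whisker_exchange` brings both sides to the same order of the generators; what remains is
  -- coherence.
  simp only [swapLeft, tensorμ, MonoidalCategory.tensorHom_def, comp_whiskerRight, Category.assoc,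
    whisker_exchange]
  monoidal

end

variable (P : A ⥤ A') (Q : B ⥤ B') [Q.Monoidal] (R : C ⥤ C') [R.Braided]
  (σ : F ⋙ Q ⟶ P ⋙ F') (ρ : G ⋙ R ⟶ Q ⋙ G') [NatTrans.IsMonoidal ρ]
  (h : ∀ X : A, sqApp ρ (F.obj X) ≫ G'.map (sqApp σ X) ≫ nullApp φ' (P.obj X) =
    R.map (nullApp φ X) ≫ η R)
variable (P₂ : A ⥤ A') (Q₂ : B ⥤ B') [Q₂.Monoidal] (R₂ : C ⥤ C') [R₂.Braided]
  (σ₂ : F ⋙ Q₂ ⟶ P₂ ⋙ F') (ρ₂ : G ⋙ R₂ ⟶ Q₂ ⋙ G') [NatTrans.IsMonoidal ρ₂]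
  (h₂ : ∀ X : A, sqApp ρ₂ (F.obj X) ≫ G'.map (sqApp σ₂ X) ≫ nullApp φ' (P₂.obj X) =
    R₂.map (nullApp φ X) ≫ η R₂)
variable {K : C ⥤ B'} [K.Monoidal] (θ : R ⟶ sumFunctor (K ⋙ G') R₂) [NatTrans.IsMonoidal θ]

/-- If `t : Q b ⟶ F' a + (K (G b) + Q₂ b)` is compatible with `θ`, then the class of
`(Q b, ρ_b)` is the composite of the class defined by `θ` with that of `(Q₂ b, ρ₂_b)`, because `t`
identifies the representatives; here an object `Z` is added on the right. -/
lemma wr_sumCls_act {b : B} {a : A'} (t : Q.obj b ⟶ F'.obj a ⊗ (K.obj (G.obj b) ⊗ Q₂.obj b))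
    (ht : sqApp ρ b ≫ G'.map t ≫ collapse φ' a _ =
      sumApp θ (G.obj b) ≫ G'.obj (K.obj (G.obj b)) ◁ sqApp ρ₂ b ≫ μ G' _ _) (Z : C') :
    wr (sumCls θ (G.obj b)) Z ≫ (proj F' G' φ').map (sqApp ρ₂ b ▷ Z) ≫ act φ' (Q₂.obj b) Z =
      (proj F' G' φ').map (sqApp ρ b ▷ Z) ≫ act φ' (Q.obj b) Z := by
  rw [← map_act_rel a t Z, ← Functor.map_comp_assoc, ← comp_whiskerRight, ht,
    sumCls_eq, wr_comp, wr_proj, wr_act]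
  simp only [Category.assoc, reassoc_of% @act_naturality, act_tensor, ← Functor.map_comp_assoc]
  congr 2
  simp

variable (J : B → A') (t : ∀ b : B, Q.obj b ⟶ F'.obj (J b) ⊗ (K.obj (G.obj b) ⊗ Q₂.obj b))

/-- Naturality of the classes defined by `θ`. For morphisms `G b + Y ⟶ Y` it splits, by
`sumCls_tensor`, into a statement about `b` and the naturality of `act` in `Y`. -/
lemma mapHom_sumCls
    (ht : ∀ b : B, sqApp ρ b ≫ G'.map (t b) ≫ collapse φ' (J b) _ =
      sumApp θ (G.obj b) ≫ G'.obj (K.obj (G.obj b)) ◁ sqApp ρ₂ b ≫ μ G' _ _) {X Y : C}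
    (f : (proj F G φ).obj X ⟶ (proj F G φ).obj Y) :
    mapHom P Q R σ ρ h f ≫ sumCls θ Y = sumCls θ X ≫ mapHom P₂ Q₂ R₂ σ₂ ρ₂ h₂ f := by
  induction f using hom_induction with
  | hproj f => rw [mapHom_proj, mapHom_proj, proj_map_sumCls]
  | hcomp f f' hf hf' =>
    rw [mapHom_comp, mapHom_comp, Category.assoc, hf', ← Category.assoc, hf, Category.assoc]
  | hact b Y =>
    rw [mapHom_act, mapHom_act, ← cancel_epi ((proj F' G' φ').map (μ R (G.obj b) Y)),
      ← Category.assoc _ (sumCls θ (G.obj b ⊗ Y)), sumCls_tensor, wr_wl_exchange,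
      Category.assoc, Category.assoc, Category.assoc, ← Functor.map_comp_assoc,
      ← Functor.map_comp_assoc, μ_δ_assoc, μ_δ_assoc, wr_sumCls_act _ _ _ _ _ _ _ _ (ht b),
      act_comp, ← wr_proj, ← wr_proj, ← Category.assoc, wr_wl_exchange, Category.assoc]

variable (ht : ∀ b : B, sqApp ρ b ≫ G'.map (t b) ≫ collapse φ' (J b) _ =
  sumApp θ (G.obj b) ≫ G'.obj (K.obj (G.obj b)) ◁ sqApp ρ₂ b ≫ μ G' _ _)

/-- The 2-cell between the functors induced on relative cokernels by `(P, Q, R)` and `(P₂, Q₂, R₂)`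
that is defined by a 2-cell `θ : R ⟶ G' ∘ K + R₂`; its component at `X` is the class of
`(K X, θ_X)`. The morphisms `t b` witness its naturality, so neither they nor the objects `J b` have
to be natural in `b`. -/
def sumTrans : map P Q R σ ρ h ⟶ map P₂ Q₂ R₂ σ₂ ρ₂ h₂ where
  app X := show (proj F' G' φ').obj (R.obj X.obj) ⟶ (proj F' G' φ').obj (R₂.obj X.obj) from
    sumCls θ X.obj
  naturality _ _ f := mapHom_sumCls P Q R σ ρ h P₂ Q₂ R₂ σ₂ ρ₂ h₂ θ J t ht f

instance sumTrans_isMonoidal :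
    NatTrans.IsMonoidal (sumTrans P Q R σ ρ h P₂ Q₂ R₂ σ₂ ρ₂ h₂ θ J t ht) where
  unit := sumCls_unit θ
  tensor X Y := sumCls_tensor θ X.obj Y.obj

end

end RelCoker

/-! ### The forgetful functor of the relative kernel -/

namespace RelKer

section Forget

variable {A : Type*} [Category A] [MonoidalCategory A]
variable {B : Type*} [Category B] [MonoidalCategory B]
variable {C : Type*} [Category C] [MonoidalCategory C]
variable (F : A ⥤ B) (G : B ⥤ C) [G.Monoidal] (φ : F ⋙ G ⟶ zeroFunctor A C)

/-- The functor `(X, a) ↦ X` from the relative kernel. -/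
def forget : RelKer F G φ ⥤ A where
  obj X := X.obj
  map f := f.hom

variable [F.Monoidal] [NatTrans.IsMonoidal φ]

instance : (forget F G φ).Monoidal :=
  Functor.CoreMonoidal.toMonoidal
    { εIso := Iso.refl _
      μIso := fun _ _ ↦ Iso.refl _
      μIso_hom_natural_left := fun f Z ↦
        (Category.comp_id (f.hom ▷ Z.obj)).trans (Category.id_comp _).symm
      μIso_hom_natural_right := fun Z f ↦
        (Category.comp_id (Z.obj ◁ f.hom)).trans (Category.id_comp _).symm
      associativity := fun X Y Z ↦ by
        change 𝟙 (X.obj ⊗ Y.obj) ▷ Z.obj ≫ 𝟙 _ ≫ (α_ X.obj Y.obj Z.obj).hom =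
          (α_ X.obj Y.obj Z.obj).hom ≫ X.obj ◁ 𝟙 (Y.obj ⊗ Z.obj) ≫ 𝟙 _
        simp
      left_unitality := fun X ↦ by
        change (λ_ X.obj).hom = 𝟙 (𝟙_ A) ▷ X.obj ≫ 𝟙 _ ≫ (λ_ X.obj).hom
        simp
      right_unitality := fun X ↦ by
        change (ρ_ X.obj).hom = X.obj ◁ 𝟙 (𝟙_ A) ≫ 𝟙 _ ≫ (ρ_ X.obj).hom
        simp }

end Forget

end RelKer

/-! ### Discarding a summand that maps to the unit -/

section

variable {A : Type*} [Category A] [MonoidalCategory A]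
variable {B : Type*} [Category B] [MonoidalCategory B]
variable {C : Type*} [Category C] [MonoidalCategory C]

lemma map_whiskerLeft_null_δ (D : B ⥤ C) [D.Monoidal] (Y : B) {U : B} (ψ : U ⟶ 𝟙_ B) (Z : B) :
    D.map (Y ◁ (ψ ▷ Z ≫ (λ_ Z).hom)) ≫ δ D Y Z =
      δ D Y (U ⊗ Z) ≫ D.obj Y ◁ (δ D U Z ≫ (D.map ψ ≫ η D) ▷ D.obj Z ≫ (λ_ (D.obj Z)).hom) := by
  rw [← δ_natural_right, comp_whiskerRight_assoc, δ_natural_left_assoc, left_unitality_hom,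
    Functor.map_comp]

lemma tensorHom_whiskerLeft_null {U V : C} (f : U ⟶ V) {W W' : C} (g : W ⟶ W') {X Y : C}
    (e : X ⟶ Y) (ψ : W' ⟶ 𝟙_ C) :
    (f ⊗ₘ (g ⊗ₘ e)) ≫ V ◁ (ψ ▷ Y ≫ (λ_ Y).hom) =
      U ◁ ((g ≫ ψ) ▷ X ≫ (λ_ X).hom) ≫ (f ⊗ₘ e) := by
  rw [← id_tensorHom, ← id_tensorHom, tensorHom_comp_tensorHom, tensorHom_comp_tensorHom,
    Category.comp_id, Category.id_comp, ← tensorHom_id ψ, tensorHom_comp_tensorHom_assoc,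
    Category.comp_id,
    ← tensorHom_id (g ≫ ψ), Category.assoc, ← leftUnitor_naturality, ← id_tensorHom (𝟙_ C),
    tensorHom_comp_tensorHom_assoc, Category.comp_id, Category.id_comp]

lemma leftUnitor_inv_whiskerLeft_null {T U X : C} (t : 𝟙_ C ⟶ T) (n : 𝟙_ C ⟶ U) (p : 𝟙_ C ⟶ X)
    (χ : U ⟶ 𝟙_ C) (hn : n ≫ χ = 𝟙 (𝟙_ C)) :
    ((λ_ (𝟙_ C)).inv ≫ (t ⊗ₘ (λ_ (𝟙_ C)).inv ≫ (n ⊗ₘ p))) ≫ T ◁ (χ ▷ X ≫ (λ_ X).hom) =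
      (λ_ (𝟙_ C)).inv ≫ (t ⊗ₘ p) := by
  rw [Category.assoc, ← id_tensorHom, tensorHom_comp_tensorHom, ← tensorHom_id, Category.assoc,
    tensorHom_comp_tensorHom_assoc, hn]
  simp

lemma tensorμ_null [BraidedCategory C] {U U' W X X' Y : C} (n : U ⊗ U' ⟶ W)
    (p : X ⊗ X' ⟶ Y) (ψ : U ⟶ 𝟙_ C) (ψ' : U' ⟶ 𝟙_ C) (χ : W ⟶ 𝟙_ C)
    (hn : n ≫ χ = (ψ ⊗ₘ ψ') ≫ (λ_ (𝟙_ C)).hom) :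
    tensorμ U X U' X' ≫ (n ⊗ₘ p) ≫ χ ▷ Y ≫ (λ_ Y).hom =
      (ψ ▷ X ≫ (λ_ X).hom ⊗ₘ ψ' ▷ X' ≫ (λ_ X').hom) ≫ p := by
  rw [← tensorHom_comp_tensorHom, leftUnitor_monoidal, ← tensorHom_id ψ, ← tensorHom_id ψ',
    Category.assoc, Category.assoc, Category.assoc, tensorμ_natural_assoc, ← tensorHom_id χ,
    tensorHom_comp_tensorHom_assoc, hn]
  simp [MonoidalCategory.tensorHom_def]

/-- Discarding the middle summand of a triple sum is compatible with the monoidal structures of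
pointwise sums. -/
lemma tensorμ_whiskerLeft_null [BraidedCategory C] {S S' T T' R U U' W X X' Y : C}
    (s : S ⟶ T ⊗ (U ⊗ X)) (s' : S' ⟶ T' ⊗ (U' ⊗ X')) (m : T ⊗ T' ⟶ R) (n : U ⊗ U' ⟶ W)
    (p : X ⊗ X' ⟶ Y) (ψ : U ⟶ 𝟙_ C) (ψ' : U' ⟶ 𝟙_ C) (χ : W ⟶ 𝟙_ C)
    (hn : n ≫ χ = (ψ ⊗ₘ ψ') ≫ (λ_ (𝟙_ C)).hom) :
    (s ⊗ₘ s') ≫ tensorμ _ _ _ _ ≫ (m ⊗ₘ tensorμ U X U' X' ≫ (n ⊗ₘ p)) ≫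
        R ◁ (χ ▷ Y ≫ (λ_ Y).hom) =
      (s ≫ T ◁ (ψ ▷ X ≫ (λ_ X).hom) ⊗ₘ s' ≫ T' ◁ (ψ' ▷ X' ≫ (λ_ X').hom)) ≫ tensorμ _ _ _ _ ≫
        (m ⊗ₘ p) := by
  rw [← tensorHom_comp_tensorHom, Category.assoc, ← id_tensorHom T, ← id_tensorHom T',
    tensorμ_natural_assoc, tensorHom_comp_tensorHom, ← id_tensorHom R,
    tensorHom_comp_tensorHom, ← tensorμ_null n p ψ ψ' χ hn]
  simp

lemma whiskerLeft_comp_null {M W U Z : C} (d : W ⟶ U ⊗ Z) (g : U ⟶ 𝟙_ C) (e : Z ⟶ 𝟙_ C)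
    (n : M ⟶ 𝟙_ C) :
    M ◁ (d ≫ g ▷ Z ≫ (λ_ Z).hom) ≫ (n ⊗ₘ e) ≫ (λ_ (𝟙_ C)).hom =
      (n ⊗ₘ d) ≫ (λ_ (U ⊗ Z)).hom ≫ (g ⊗ₘ e) ≫ (λ_ (𝟙_ C)).hom := by
  have h : (g ⊗ₘ e) ≫ (λ_ (𝟙_ C)).hom = g ▷ Z ≫ (λ_ Z).hom ≫ e := by
    rw [MonoidalCategory.tensorHom_def, Category.assoc, leftUnitor_naturality]
  rw [h, ← leftUnitor_naturality, ← id_tensorHom, ← id_tensorHom, tensorHom_comp_tensorHom_assoc,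
    tensorHom_comp_tensorHom_assoc]
  simp

end

/-! ### The 2-cell induced by a homotopy -/

namespace TwoChainComplex

namespace Homotopy

variable {A B : TwoChainComplex.{v, u}} {F G : Hom A B} (h : Homotopy F G) (k : ℤ)

/-- The morphism `H (d X) ⟶ H 0 ≅ 0` given by `a` on a cycle `(X, a : d X ⟶ 0)`. -/
def cycleNull (X : A.Cycles k) :
    (h.H (k + 1)).functor.obj ((A.d (k + 1)).functor.obj X.obj) ⟶ 𝟙_ (B.obj (k + 1 + 1)) :=
  (h.H (k + 1)).functor.map X.arr ≫ η (h.H (k + 1)).functor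

lemma cycleNull_naturality {X Y : A.Cycles k} (f : X ⟶ Y) :
    (h.H (k + 1)).functor.map ((A.d (k + 1)).functor.map f.hom) ≫ h.cycleNull k Y =
      h.cycleNull k X := by
  rw [cycleNull, cycleNull, ← Functor.map_comp_assoc, f.w]

lemma ε_cycleNull :
    ε (h.H (k + 1)).functor ≫ (h.H (k + 1)).functor.map (ε (A.d (k + 1)).functor) ≫
      h.cycleNull k (𝟙_ (A.Cycles k)) = 𝟙 _ := by
  simp [cycleNull]

lemma μ_cycleNull (X Y : A.Cycles k) :
    μ (h.H (k + 1)).functor _ _ ≫ (h.H (k + 1)).functor.map (μ (A.d (k + 1)).functor _ _) ≫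
      h.cycleNull k (X ⊗ Y) = (h.cycleNull k X ⊗ₘ h.cycleNull k Y) ≫ (λ_ _).hom := by
  rw [cycleNull, RelKer.tensorObj_arr, Functor.map_comp, Functor.map_comp, Category.assoc,
    Category.assoc, map_tensor_null, map_μ_δ_assoc, μ_δ_assoc]
  rfl

/-- The morphism `F X ⟶ d (H X) + (H (d X) + G X) ⟶ d (H X) + G X` on a cycle `(X, a)`. -/
def cycleApp (X : A.Cycles k) :
    (F.hom (k + 1 + 1)).functor.obj X.obj ⟶
      (B.d (k + 1 + 1)).functor.obj ((h.H (k + 1 + 1)).functor.obj X.obj) ⊗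
        (G.hom (k + 1 + 1)).functor.obj X.obj :=
  homotopyApp h.τ (k + 1) X.obj ≫ _ ◁ (h.cycleNull k X ▷ _ ≫ (λ_ _).hom)

lemma homotopyApp_naturality {X Y : A.obj (k + 1)} (f : X ⟶ Y) :
    (F.hom (k + 1)).functor.map f ≫ homotopyApp h.τ k Y =
      homotopyApp h.τ k X ≫
        ((B.d (k + 1)).functor.map ((h.H (k + 1)).functor.map f) ⊗ₘ
          ((h.H k).functor.map ((A.d k).functor.map f) ⊗ₘ (G.hom (k + 1)).functor.map f)) :=
  (h.τ k).naturality f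

lemma ε_homotopyApp :
    ε (F.hom (k + 1)).functor ≫ homotopyApp h.τ k (𝟙_ (A.obj (k + 1))) =
      (λ_ _).inv ≫
        (ε (B.d (k + 1)).functor ≫ (B.d (k + 1)).functor.map (ε (h.H (k + 1)).functor) ⊗ₘ
          ((λ_ _).inv ≫ (ε (h.H k).functor ≫ (h.H k).functor.map (ε (A.d k).functor) ⊗ₘ
            ε (G.hom (k + 1)).functor))) :=
  NatTrans.IsMonoidal.unit (τ := h.τ k)

lemma μ_homotopyApp (X Y : A.obj (k + 1)) :
    μ (F.hom (k + 1)).functor X Y ≫ homotopyApp h.τ k (X ⊗ Y) =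
      (homotopyApp h.τ k X ⊗ₘ homotopyApp h.τ k Y) ≫ tensorμ _ _ _ _ ≫
        (μ (B.d (k + 1)).functor _ _ ≫ (B.d (k + 1)).functor.map (μ (h.H (k + 1)).functor X Y) ⊗ₘ
          (tensorμ _ _ _ _ ≫
            (μ (h.H k).functor _ _ ≫ (h.H k).functor.map (μ (A.d k).functor X Y) ⊗ₘ
              μ (G.hom (k + 1)).functor X Y))) :=
  NatTrans.IsMonoidal.tensor (τ := h.τ k) X Y

/-- Once the images of `0` under all functors involved are identified with `0`, the component of `τ`
at `0` becomes the identity. -/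
lemma homotopyApp_unit_η :
    homotopyApp h.τ k (𝟙_ (A.obj (k + 1))) ≫
      ((B.d (k + 1)).functor.map (η (h.H (k + 1)).functor) ≫ η (B.d (k + 1)).functor ⊗ₘ
        ((h.H k).functor.map (η (A.d k).functor) ≫ η (h.H k).functor ⊗ₘ
          η (G.hom (k + 1)).functor) ≫ (λ_ _).hom) ≫ (λ_ _).hom =
      η (F.hom (k + 1)).functor := by
  rw [← cancel_epi (ε (F.hom (k + 1)).functor), reassoc_of% h.ε_homotopyApp k]
  simp

/-- On a cycle `(X, a)`, the morphism `F X ⟶ d (H X) + G X` is compatible with the morphisms from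
the differentials of both sides to the unit. By the axiom of a homotopy at `X`, this reduces to the
naturality of `τ` with respect to `a : d X ⟶ 0`. -/
lemma map_cycleApp (X : A.Cycles k) :
    (B.d (k + 1)).functor.map (h.cycleApp k X) ≫ δ (B.d (k + 1)).functor _ _ ≫
      (nullApp (B.α (k + 1)) ((h.H (k + 1 + 1)).functor.obj X.obj) ⊗ₘ
        (inv (sqApp (G.cell (k + 1)) X.obj) ≫ (G.hom (k + 1)).functor.map X.arr ≫
          η (G.hom (k + 1)).functor)) ≫ (λ_ _).hom =
      inv (sqApp (F.cell (k + 1)) X.obj) ≫ (F.hom (k + 1)).functor.map X.arr ≫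
          η (F.hom (k + 1)).functor := by
  have hc := h.τ_compat k X.obj
  rw [← cancel_epi (sqApp (F.cell (k + 1)) X.obj), IsIso.hom_inv_id_assoc,
    ← h.homotopyApp_unit_η k, reassoc_of% h.homotopyApp_naturality k]
  have h1 (e : (B.d (k + 1)).functor.obj ((G.hom (k + 1 + 1)).functor.obj X.obj) ⟶ 𝟙_ _) :
      sqApp (F.cell (k + 1)) X.obj ≫ (B.d (k + 1)).functor.map (h.cycleApp k X) ≫
        δ (B.d (k + 1)).functor _ _ ≫
      (nullApp (B.α (k + 1)) ((h.H (k + 1 + 1)).functor.obj X.obj) ⊗ₘ e) ≫ (λ_ _).hom =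
      homotopyLeft h.τ k X.obj ≫
        ((B.d (k + 1)).functor.map (h.cycleNull k X) ≫ η (B.d (k + 1)).functor ⊗ₘ e) ≫
          (λ_ _).hom := by
    rw [homotopyLeft, cycleApp, Functor.map_comp, Category.assoc,
      reassoc_of% map_whiskerLeft_null_δ]
    simp only [Category.assoc, whiskerLeft_comp_null]
  -- The cycle condition `X.w` turns `H (α_X)` into `H (d a)`, so that every summand is the image
  -- of `a`.
  rw [h1, hc, homotopyRight, cycleNull, Category.assoc, ← X.w, ← id_tensorHom,
    tensorHom_comp_tensorHom_assoc, tensorHom_comp_tensorHom_assoc]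
  simp only [Functor.map_comp, Category.assoc, Category.id_comp]
  rw [← leftUnitor_naturality, ← id_tensorHom, tensorHom_comp_tensorHom_assoc,
    IsIso.hom_inv_id_assoc, Category.comp_id, tensorHom_comp_tensorHom_assoc]

/-- The 2-cell `F ⟶ d ∘ H + G` between functors on the cycles in degree `k + 2` that is defined by a
homotopy from `F` to `G`. -/
noncomputable def cycleTrans : cyclesMap F k ⟶
    sumFunctor ((RelKer.forget _ _ (A.α k) ⋙ (h.H (k + 1 + 1)).functor) ⋙ B.toCycles k)
      (cyclesMap G k) where
  app X := show (cyclesMap F k).obj X ⟶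
      (B.toCycles k).obj ((h.H (k + 1 + 1)).functor.obj X.obj) ⊗ (cyclesMap G k).obj X from
    { hom := h.cycleApp k X
      w := h.map_cycleApp k X }
  naturality X Y f := RelKer.hom_ext <| by
    change (F.hom (k + 1 + 1)).functor.map f.hom ≫ h.cycleApp k Y = h.cycleApp k X ≫
      ((B.d (k + 1 + 1)).functor.map ((h.H (k + 1 + 1)).functor.map f.hom) ⊗ₘ
        (G.hom (k + 1 + 1)).functor.map f.hom)
    rw [cycleApp, reassoc_of% h.homotopyApp_naturality (k + 1), cycleApp,
      ← h.cycleNull_naturality k f, tensorHom_whiskerLeft_null, Category.assoc]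

instance : NatTrans.IsMonoidal (h.cycleTrans k) where
  unit := RelKer.hom_ext <| by
    change ε (F.hom (k + 1 + 1)).functor ≫ h.cycleApp k (𝟙_ _) = (λ_ _).inv ≫
        (ε (B.d (k + 1 + 1)).functor ≫
          (B.d (k + 1 + 1)).functor.map (ε (h.H (k + 1 + 1)).functor ≫
            (h.H (k + 1 + 1)).functor.map (𝟙 _)) ⊗ₘ
          ε (G.hom (k + 1 + 1)).functor)
    refine (Category.assoc _ _ _).symm.trans ?_
    refine (congrArg (· ≫ _) (h.ε_homotopyApp (k + 1))).trans ?_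
    rw [CategoryTheory.Functor.map_id, Category.comp_id]
    exact leftUnitor_inv_whiskerLeft_null _ _ _ _ ((Category.assoc _ _ _).trans (h.ε_cycleNull k))
  tensor X Y := RelKer.hom_ext <| by
    change μ (F.hom (k + 1 + 1)).functor _ _ ≫ h.cycleApp k (X ⊗ Y) =
        (h.cycleApp k X ⊗ₘ h.cycleApp k Y) ≫ tensorμ _ _ _ _ ≫
        (μ (B.d (k + 1 + 1)).functor _ _ ≫
          (B.d (k + 1 + 1)).functor.map (μ (h.H (k + 1 + 1)).functor _ _ ≫
            (h.H (k + 1 + 1)).functor.map (𝟙 _)) ⊗ₘ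
          μ (G.hom (k + 1 + 1)).functor _ _)
    rw [CategoryTheory.Functor.map_id, Category.comp_id]
    refine (Category.assoc _ _ _).symm.trans ?_
    refine (congrArg (· ≫ _) (h.μ_homotopyApp (k + 1) X.obj Y.obj)).trans ?_
    simp only [Category.assoc]
    exact tensorμ_whiskerLeft_null _ _ _ _ _ _ _ _
      ((Category.assoc _ _ _).trans (h.μ_cycleNull k X Y))

/-- The component of `τ` at `b` witnesses the naturality of the induced 2-cell at `b`; this is the
axiom of a homotopy at `b`. -/
lemma cycleTrans_compat (b : A.obj (k + 1 + 1 + 1)) :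
    sqApp (cyclesCell F k) b ≫ (B.toCycles k).map (homotopyApp h.τ (k + 1 + 1) b) ≫
      collapse (B.toCyclesNull k) ((h.H (k + 1 + 1 + 1)).functor.obj b) _ =
    RelCoker.sumApp (h.cycleTrans k) ((A.toCycles k).obj b) ≫
      (B.toCycles k).obj ((h.H (k + 1 + 1)).functor.obj ((A.d (k + 1 + 1)).functor.obj b)) ◁
        sqApp (cyclesCell G k) b ≫ μ (B.toCycles k) _ _ := by
  refine RelKer.hom_ext ?_
  have hc := h.τ_compat (k + 1) b
  change sqApp (F.cell (k + 1 + 1)) b ≫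
      (B.d (k + 1 + 1)).functor.map (homotopyApp h.τ (k + 1 + 1) b) ≫
        δ (B.d (k + 1 + 1)).functor _ _ ≫ nullApp (B.α (k + 1 + 1)) _ ▷ _ ≫ (λ_ _).hom =
    (homotopyApp h.τ (k + 1) ((A.d (k + 1 + 1)).functor.obj b) ≫
      _ ◁ (((h.H (k + 1)).functor.map (nullApp (A.α (k + 1)) b) ≫ η (h.H (k + 1)).functor) ▷ _ ≫
        (λ_ _).hom)) ≫ _ ◁ sqApp (G.cell (k + 1 + 1)) b ≫ μ (B.d (k + 1 + 1)).functor _ _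
  rw [← cancel_mono (δ (B.d (k + 1 + 1)).functor _ _)]
  simp only [Category.assoc, μ_δ, Category.comp_id]
  rw [← leftUnitor_naturality, ← MonoidalCategory.tensorHom_def_assoc]
  refine hc.trans ?_
  rw [homotopyRight, MonoidalCategory.tensorHom_def (_ ≫ _), Category.assoc,
    leftUnitor_naturality, ← MonoidalCategory.whiskerLeft_comp, Category.assoc]

/-- The 2-morphism between the 1-morphisms induced on homology in degree `k + 2` that is defined by
a homotopy from `F` to `G`. -/
noncomputable def homologyTrans : homologyMapAux F k ⟶ homologyMapAux G k :=
  SymTwoGroup.Hom₂.mk (A := A.homologyAux k) (B := B.homologyAux k)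
    (F := homologyMapAux F k) (G := homologyMapAux G k)
    (RelCoker.sumTrans _ _ _ _ _ (cyclesCell_compat F k) _ _ _ _ _ (cyclesCell_compat G k)
      (h.cycleTrans k) _ _ (h.cycleTrans_compat k))
    (isMonoidal := RelCoker.sumTrans_isMonoidal _ _ _ _ _ (cyclesCell_compat F k)
      _ _ _ _ _ (cyclesCell_compat G k) (h.cycleTrans k) _ _ (h.cycleTrans_compat k))

end Homotopy

end TwoChainComplex

/-- Every 2-morphism of symmetric 2-groups is invertible, since it is so on every object. -/
noncomputable def SymTwoGroup.isoOfHom {A B : SymTwoGroup.{v, u}} {F G : SymTwoGroup.Hom A B}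
    (f : F ⟶ G) : F ≅ G :=
  have : IsIso f.natTrans := NatIso.isIso_of_isIso_app _
  have : NatTrans.IsMonoidal (asIso f.natTrans).hom := f.isMonoidal
  { hom := f
    inv :=
      { natTrans := inv f.natTrans
        isMonoidal := inferInstanceAs (NatTrans.IsMonoidal (asIso f.natTrans).inv) }
    hom_inv_id := SymTwoGroup.Hom₂.ext (IsIso.hom_inv_id f.natTrans)
    inv_hom_id := SymTwoGroup.Hom₂.ext (IsIso.inv_hom_id f.natTrans) }

theorem proposition1 {A B : TwoChainComplex.{v, u}} (F G : TwoChainComplex.Hom A B)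
    (h : TwoChainComplex.Homotopy F G) (n : ℤ) :
    Nonempty (TwoChainComplex.homologyMap F n ≅ TwoChainComplex.homologyMap G n) :=
  ⟨SymTwoGroup.isoOfHom (h.homologyTrans (n - 2))⟩
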